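/- Let $d \ge 1$. Write $\mathcal{S}'(\mathbf{R}^d)$ for the space of real distributions on $\mathbf{R}^d$ (not necessarily tempered), i.e. continuous linear functionals on the real smooth compactly supported test functions, with the topology of uniform convergence on compact sets of test functions. For a test function $\phi$, $x\in\mathbf{R}^d$ and $\lambda>0$ put $\phi_x^\lambda(y)=\lambda^{-d}\phi(\lambda^{-1}(y-x))$. For an integer $r$ let $\mathcal{B}_r$ be the set of smooth $\phi\colon\mathbf{R}^d\to\mathbf{R}$ supported in the closed unit ball around $0$ all of whose derivatives of order at most $r$ are bounded by $1$. For $\gamma\in\mathbf{R}$ let $r=\lfloor|\gamma|\rfloor+1$, and let $\mathcal{C}^\gamma=\mathcal{C}^\gamma(\mathbf{R}^d)$ (that is, $B^\gamma_{\infty,\infty,\mathrm{loc}}$) be the space of distributions $\xi$ such that, for every compact set $K\subset\mathbf{R}^d$, $$\|\xi\|_{\gamma;K}=\max\Bigl\{\ \sup_{x\in K}\ \sup_{\phi\in\mathcal{B}_r}|\xi(\phi_x^1)|\ ,\ \ \sup_{x\in K}\ \sup_{\lambda\in(0,1]}\ \sup_{\phi}\ \lambda^{-\gamma}|\xi(\phi_x^\lambda)|\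 \Bigr\}<\infty,$$ where the last supremum runs over those $\phi\in\mathcal{B}_r$ with $\int\phi(y)P(y)\,dy=0$ for every polynomial $P$ of degree at most $\gamma$ (no condition if $\gamma<0$). The space $\mathcal{C}^\gamma$ carries the locally convex topology generated by the seminorms $\|\cdot\|_{\gamma;K}$. For $\gamma\in(0,\infty)\setminus\mathbf{N}$ it is the usual space of locally $\gamma$-Hölder functions. A continuous function $f$ is identified with the distribution $\phi\mapsto\int f\phi$. **Theorem.** Let $\alpha>0$ and $\beta>\alpha$. There is a jointly continuous bilinear map $$B\colon \mathcal{C}^{-\alpha}\times\mathcal{C}^{\beta}\to\mathcal{S}'(\mathbf{R}^d)$$ such that $B(f,g)=fg$ for any two continuous functions $f$ and $g$ with $g\in\mathcal{C}^\beta$ (every continuous $f$ belongs to $\mathcal{C}^{-\alpha}$). -/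

import Mathlib

open MeasureTheory TopologicalSpace
open scoped Distributions ContDiff

noncomputable section

namespace HolderBesov

/-- Euclidean space `ℝ^d`. -/
abbrev Rd (d : ℕ) : Type := EuclideanSpace ℝ (Fin d)

/-- Real-valued smooth compactly supported test functions on `ℝ^d`, with the usual
(inductive limit) topology. -/
abbrev Test (d : ℕ) : Type := 𝓓((⊤ : Opens (Rd d)), ℝ)

/-- Real distributions on `ℝ^d` (not necessarily tempered), with the topology of uniform
convergence on compact (equivalently, on bounded) sets of test functions. -/
abbrev Distr (d : ℕ) : Type := 𝓓'((⊤ : Opens (Rd d)), ℝ)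

/-- The rescaled and recentred test function `φ_x^l (y) = l^{-d} φ (l⁻¹ (y - x))`, for `l > 0`. -/
def rescale {d : ℕ} (φ : Test d) (x : Rd d) (l : ℝ) (hl : 0 < l) : Test d where
  toFun y := (l ^ d)⁻¹ * φ (l⁻¹ • (y - x))
  contDiff' := contDiff_const.mul
    (φ.contDiff.comp ((contDiff_id.sub contDiff_const).const_smul l⁻¹))
  hasCompactSupport' := by
    have h := φ.hasCompactSupport.comp_homeomorph
      ((Homeomorph.subRight x).trans (Homeomorph.smulOfNeZero l⁻¹ (inv_ne_zero hl.ne')))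
    exact HasCompactSupport.mul_left h
  tsupport_subset' := fun _ _ => trivial

/-- The set `B_r`: smooth functions supported in the closed unit ball around the origin, all of
whose derivatives of order at most `r` are bounded by `1`. -/
def unitTests (d r : ℕ) : Set (Test d) :=
  {φ | tsupport (φ : Rd d → ℝ) ⊆ Metric.closedBall 0 1 ∧
    ∀ k ≤ r, ∀ y, ‖iteratedFDeriv ℝ k (φ : Rd d → ℝ) y‖ ≤ 1}

/-- `φ` integrates to zero against all monomials, hence against all polynomials, of degree at most
`γ`. For `γ < 0` this is no condition. -/
def Annihilates {d : ℕ} (γ : ℝ) (φ : Test d) : Prop :=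
  ∀ k : Fin d → ℕ, ((∑ i, k i : ℕ) : ℝ) ≤ γ → ∫ y : Rd d, φ y * ∏ i, y i ^ k i = 0

/-- The least integer `r` with `r > |γ|`. -/
def testOrder (γ : ℝ) : ℕ := ⌊|γ|⌋₊ + 1

/-- The normalised test functions that measure `C^γ` regularity over the set `K`: the functions
`φ_x^1` for `φ ∈ B_r` and `x ∈ K`, and the functions `l^{-γ} φ_x^l` for `x ∈ K`, `0 < l ≤ 1` and
`φ ∈ B_r` annihilating all polynomials of degree at most `γ`. Here `r > |γ|`. -/
def gauges {d : ℕ} (γ : ℝ) (K : Set (Rd d)) : Set (Test d) :=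
  {ψ | ∃ φ ∈ unitTests d (testOrder γ), ∃ x ∈ K, ψ = rescale φ x 1 one_pos} ∪
  {ψ | ∃ φ ∈ unitTests d (testOrder γ), Annihilates γ φ ∧ ∃ x ∈ K, ∃ (l : ℝ) (hl : 0 < l),
    l ≤ 1 ∧ ψ = l ^ (-γ) • rescale φ x l hl}

/-- The linear space of distributions `ξ` of class `C^γ = B^γ_{∞,∞,loc}` on `ℝ^d`, `γ ∈ ℝ`: locally
uniformly in `x`, one has `|ξ(φ_x^1)| ≲ 1` for `φ ∈ B_r`, and `|ξ(φ_x^l)| ≲ l^γ` for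
`l ∈ (0,1]` and those `φ ∈ B_r` that annihilate polynomials of degree at most `γ`. -/
def holderSubmodule (d : ℕ) (γ : ℝ) : Submodule ℝ (Distr d) where
  carrier := {ξ | ∀ K : Compacts (Rd d), ∃ C : ℝ, ∀ ψ ∈ gauges γ (K : Set (Rd d)), |ξ ψ| ≤ C}
  zero_mem' := fun _ => ⟨0, fun ψ _ => by simp⟩
  add_mem' := by
    intro ξ ζ hξ hζ K
    obtain ⟨C, hC⟩ := hξ K
    obtain ⟨D, hD⟩ := hζ K
    exact ⟨C + D, fun ψ hψ => (abs_add_le (ξ ψ) (ζ ψ)).trans (add_le_add (hC ψ hψ) (hD ψ hψ))⟩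
  smul_mem' := by
    intro c ξ hξ K
    obtain ⟨C, hC⟩ := hξ K
    refine ⟨|c| * C, fun ψ hψ => ?_⟩
    change |c * ξ ψ| ≤ _
    rw [abs_mul]
    exact mul_le_mul_of_nonneg_left (hC ψ hψ) (abs_nonneg c)

/-- The space `C^γ(ℝ^d)` as a type of its own, so that it carries its own topology rather than
the one induced by the space of distributions. -/
def Holder (d : ℕ) (γ : ℝ) : Type := holderSubmodule d γ

instance (d : ℕ) (γ : ℝ) : AddCommGroup (Holder d γ) :=
  inferInstanceAs (AddCommGroup (holderSubmodule d γ))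

instance (d : ℕ) (γ : ℝ) : Module ℝ (Holder d γ) :=
  inferInstanceAs (Module ℝ (holderSubmodule d γ))

/-- The distribution underlying an element of `C^γ`. -/
def Holder.toDistr {d : ℕ} {γ : ℝ} : Holder d γ →ₗ[ℝ] Distr d := (holderSubmodule d γ).subtype

theorem Holder.bddAbove {d : ℕ} {γ : ℝ} (ξ : Holder d γ) (K : Compacts (Rd d)) :
    BddAbove (Set.range fun ψ : gauges γ (K : Set (Rd d)) => |ξ.toDistr ψ.1|) := by
  obtain ⟨C, hC⟩ := ξ.2 K
  exact ⟨C, by rintro _ ⟨ψ, rfl⟩; exact hC ψ.1 ψ.2⟩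

/-- The `C^γ` seminorm over the compact set `K`. -/
def holderSeminorm (d : ℕ) (γ : ℝ) (K : Compacts (Rd d)) : Seminorm ℝ (Holder d γ) :=
  Seminorm.of (fun ξ => ⨆ ψ : gauges γ (K : Set (Rd d)), |ξ.toDistr ψ.1|)
    (by
      intro ξ ζ
      have h0 : ∀ η : Holder d γ, 0 ≤ ⨆ ψ : gauges γ (K : Set (Rd d)), |η.toDistr ψ.1| :=
        fun η => Real.iSup_nonneg fun _ => abs_nonneg _
      refine Real.iSup_le (fun ψ => ?_) (add_nonneg (h0 ξ) (h0 ζ))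
      rw [map_add]
      exact (abs_add_le (ξ.toDistr ψ.1) (ζ.toDistr ψ.1)).trans
        (add_le_add (le_ciSup (ξ.bddAbove K) ψ) (le_ciSup (ζ.bddAbove K) ψ)))
    (by
      intro c ξ
      rw [Real.norm_eq_abs, Real.mul_iSup_of_nonneg (abs_nonneg c)]
      refine iSup_congr fun ψ => ?_
      rw [map_smul]
      exact abs_mul c (ξ.toDistr ψ.1))

/-- The locally convex topology of `C^γ`, generated by the seminorms over all compact sets. -/
instance (d : ℕ) (γ : ℝ) : TopologicalSpace (Holder d γ) :=
  SeminormFamily.moduleFilterBasis (𝕜 := ℝ) (holderSeminorm d γ) |>.topology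

/-- The distribution `φ ↦ ∫ f φ` given by a continuous function `f`. -/
def ofContinuous {d : ℕ} (f : C(Rd d, ℝ)) : Distr d where
  toFun φ := ∫ y, f y * φ y
  map_add' φ ψ := by
    have hi : ∀ χ : Test d, Integrable (fun y => f y * χ y) := fun χ =>
      (f.continuous.mul χ.continuous).integrable_of_hasCompactSupport χ.hasCompactSupport.mul_left
    rw [← integral_add (hi φ) (hi ψ)]
    refine integral_congr_ae (Filter.Eventually.of_forall fun y => ?_)
    exact mul_add (f y) (φ y) (ψ y)
  map_smul' c φ := by
    rw [RingHom.id_apply, smul_eq_mul, ← integral_const_mul]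
    refine integral_congr_ae (Filter.Eventually.of_forall fun y => ?_)
    exact mul_left_comm (f y) c (φ y)
  cont := by
    have hf : LocallyIntegrableOn f ((⊤ : Opens (Rd d)) : Set (Rd d)) volume :=
      f.continuous.locallyIntegrable.locallyIntegrableOn _
    refine (TestFunction.integralAgainstBilinCLM (𝕜 := ℝ) (n := ⊤) (Ω := (⊤ : Opens (Rd d)))
      (ContinuousLinearMap.mul ℝ ℝ) volume f).continuous.congr fun φ => ?_
    rw [TestFunction.integralAgainstBilinCLM_eq_integral hf]
    exact integral_congr_ae (Filter.Eventually.of_forall fun y => mul_comm (φ y) (f y))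

end HolderBesov

end

noncomputable section
open Filter Topology Metric
open scoped LineDeriv
namespace HolderBesov

/-! Mollify the regular factor and telescope over dyadic scales. Let `ρ` be a test function of
integral one whose moments of positive degree up to at least `β` vanish, and let `g_n(y) = g(ρ_y^l)`
with `l = 2^{-n}`. Each `g_n` is smooth, so `f g_n` makes sense for every distribution `f`. Moreover
`g_{n+1}(y) - g_n(y) = g(κ_y^l)`, where `κ = ρ^{1/2} - ρ` annihilates all polynomials of degree at
most `β`. A derivative in `y` falls on the kernel, costs a factor `l⁻¹` and preserves the
annihilation (`iteratedFDeriv_smear_apply`, `annihilates_lineDeriv`). Hence the `k`-th derivative of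
`g_{n+1} - g_n` is of order `l^{β-k}`, locally uniformly (`norm_iteratedFDeriv_smear_le`).

For a test function `φ`, the function `(g_{n+1} - g_n) φ` therefore has size `l^β` and varies at
scale `l`. A partition of unity at scale `l` cuts it into about `l^{-d}` bumps. On each of them `f`
contributes at most a multiple of `l^d l^{-α} l^β`, so the total is of order `l^{β-α}`
(`exists_bound_of_scale`, `exists_bound_mulTest`). Since `β > α`, the corrections sum geometrically.
The product is the coarse term `f g_0` plus this series, and it is bounded by a product of one
seminorm of `f`, one of `g` and finitely many derivatives of `φ` (`exists_bound_prodPairing`).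

This bound gives a distribution and also joint continuity, because a compact set of test functions
has a common support and uniformly bounded derivatives. For continuous `f` and `g` the telescoped
sum is the limit of `∫ f g_n φ`, which is `∫ f g φ` by dominated convergence. -/

variable {d : ℕ} {γ δ : ℝ}

/-! ### Test functions and distributions -/

/-- The iterated derivatives of a compact set of test functions are uniformly bounded. -/
theorem exists_bound_iteratedFDeriv {E : Type} [NormedAddCommGroup E] [NormedSpace ℝ E] (k : ℕ) :
    ∀ {F : Type} [NormedAddCommGroup F] [NormedSpace ℝ F] {Ω : Opens E} {S : Set 𝓓(Ω, F)},
      IsCompact S → ∃ C : ℝ, ∀ φ ∈ S, ∀ x, ‖iteratedFDeriv ℝ k (φ : E → F) x‖ ≤ C := by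
  induction k with
  | zero =>
    intro F _ _ Ω S hS
    obtain ⟨C, hC⟩ := (hS.image
      (TestFunction.toBoundedContinuousFunctionCLM ℝ).continuous).isBounded.exists_norm_le
    refine ⟨C, fun φ hφ x => ?_⟩
    rw [norm_iteratedFDeriv_zero]
    exact (BoundedContinuousFunction.norm_coe_le_norm
      (TestFunction.toBoundedContinuousFunctionCLM ℝ φ) x).trans (hC _ ⟨φ, hφ, rfl⟩)
  | succ k ih =>
    intro F _ _ Ω S hS
    -- Differentiation is continuous, so it maps `S` to a compact set of test functions with values
    -- in another space; this is why `F` is quantified inside the induction.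
    obtain ⟨C, hC⟩ := ih (hS.image (TestFunction.fderivCLM ℝ ⊤ ⊤).continuous)
    refine ⟨C, fun φ hφ x => ?_⟩
    have h := hC _ ⟨φ, hφ, rfl⟩ x
    rwa [TestFunction.fderivCLM_apply_of_le _ (by simp), norm_iteratedFDeriv_fderiv] at h

/-- The elements of a compact set of test functions are supported in a common ball. -/
theorem exists_common_radius {d : ℕ} {S : Set (Test d)} (hS : IsCompact S) :
    ∃ R : ℝ, ∀ φ ∈ S, ∀ y, R < ‖y‖ → φ y = 0 := by
  by_contra! H
  choose φ hφ x hx hne using fun n : ℕ => H n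
  -- The weights make `c n * |φ n (x n)| = n`. The map `ψ ↦ (c n * ψ (x n))_n` into bounded
  -- sequences is continuous, since a compact support contains only finitely many of the points `x
  -- n`, which escape to infinity. Its image of `S` is then bounded, yet contains elements of norm
  -- at least `n` for every `n`.
  let c : ℕ → ℝ := fun n => n / |φ n (x n)|
  have hc : ∀ n, 0 ≤ c n := fun n => by positivity
  have hbd : ∀ (K : Compacts (Rd d)), ∃ C, 0 ≤ C ∧ ∀ ψ : Test d, (∀ y ∉ K, ψ y = 0) →
      ∀ A, (∀ y, |ψ y| ≤ A) → ∀ n, |c n * ψ (x n)| ≤ C * A := by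
    intro K
    obtain ⟨R, hR⟩ := K.isCompact.isBounded.exists_norm_le
    obtain ⟨N, hN⟩ := exists_nat_ge R
    refine ⟨∑ n ∈ Finset.range (N + 1), c n, Finset.sum_nonneg fun n _ => hc n, ?_⟩
    intro ψ hψ A hA n
    have hA0 : 0 ≤ A := (abs_nonneg _).trans (hA 0)
    by_cases hn : n < N + 1
    · rw [abs_mul, abs_of_nonneg (hc n)]
      gcongr
      · exact Finset.single_le_sum (f := c) (fun n _ => hc n) (Finset.mem_range.2 hn)
      · exact hA _
    · rw [hψ, mul_zero, abs_zero]
      · exact mul_nonneg (Finset.sum_nonneg fun n _ => hc n) hA0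
      · intro h
        have h1 := hR _ h
        have h2 := hx n
        have h3 : (N : ℝ) ≤ n := by exact_mod_cast (by omega : N ≤ n)
        linarith
  have hbdd : ∀ ψ : Test d, ∃ C, ∀ n, ‖c n * ψ (x n)‖ ≤ C := by
    intro ψ
    obtain ⟨C, -, hC⟩ := hbd ⟨tsupport ψ, ψ.hasCompactSupport⟩
    obtain ⟨A, hA⟩ := ψ.hasCompactSupport.exists_bound_of_continuous ψ.continuous
    exact ⟨C * A, hC ψ (fun y hy => image_eq_zero_of_notMem_tsupport hy) A hA⟩
  let T : Test d →L[ℝ] BoundedContinuousFunction ℕ ℝ := TestFunction.mkCLM ℝ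
    (fun ψ => BoundedContinuousFunction.ofNormedAddCommGroup (fun n => c n * ψ (x n))
      continuous_of_discreteTopology _ (hbdd ψ).choose_spec)
    (fun f g => by ext n; exact mul_add _ _ _)
    (fun a f => by ext n; exact mul_left_comm _ _ _)
    (fun K hK => by
      obtain ⟨C, hC0, hC⟩ := hbd K
      refine (ContDiffMapSupportedIn.mkCLMtoNormedSpace ℝ (n := ⊤) (K := K) (F := ℝ)
        (fun ψ => BoundedContinuousFunction.ofNormedAddCommGroup
          (fun n => c n * TestFunction.ofSupportedIn hK ψ (x n))
        continuous_of_discreteTopology _ (hbdd _).choose_spec)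
        (fun f g => by ext n; exact mul_add _ _ _)
        (fun a f => by ext n; exact mul_left_comm _ _ _)
        ⟨{0}, C, hC0, fun f => ?_⟩).continuous
      rw [Finset.sup_singleton]
      refine BoundedContinuousFunction.norm_ofNormedAddCommGroup_le _
        (mul_nonneg hC0 (apply_nonneg _ _)) ?_
      exact hC _ (fun y hy => f.zero_on_compl hy) _
        fun y => ContDiffMapSupportedIn.norm_apply_le_seminorm ℝ (f := f) (x := y))
  obtain ⟨C, hC⟩ := (hS.image T.continuous).isBounded.exists_norm_le
  obtain ⟨n, hn⟩ := exists_nat_gt C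
  have h1 := ((T (φ n)).norm_coe_le_norm n).trans (hC _ ⟨φ n, hφ n, rfl⟩)
  have h2 : ‖T (φ n) n‖ = n := by
    change |c n * φ n (x n)| = n
    rw [abs_mul, abs_of_nonneg (hc n)]
    exact div_mul_cancel₀ _ (abs_ne_zero.2 (hne n))
  linarith

/-- A linear functional on test functions which is locally of finite order is a distribution. -/
def distrOfBound {d : ℕ} (r : ℕ) (T : Test d →ₗ[ℝ] ℝ)
    (hT : ∀ R : ℝ, ∃ C : ℝ, 0 ≤ C ∧ ∀ (φ : Test d) (A : ℝ), (∀ y, R < ‖y‖ → φ y = 0) →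
      (∀ k ≤ r, ∀ y, ‖iteratedFDeriv ℝ k (φ : Rd d → ℝ) y‖ ≤ A) → |T φ| ≤ C * A) : Distr d :=
  TestFunction.mkCLM ℝ T T.map_add T.map_smul fun K hK => by
    obtain ⟨R, hR⟩ := K.isCompact.isBounded.exists_norm_le
    obtain ⟨C, hC0, hC⟩ := hT R
    refine (ContDiffMapSupportedIn.mkCLMtoNormedSpace ℝ (n := ⊤) (K := K) (F := ℝ)
      (fun ψ => T (TestFunction.ofSupportedIn hK ψ))
      (fun f g => T.map_add (TestFunction.ofSupportedIn hK f) (TestFunction.ofSupportedIn hK g))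
      (fun a f => T.map_smul a (TestFunction.ofSupportedIn hK f))
      ⟨Finset.range (r + 1), C, hC0, fun f => ?_⟩).continuous
    refine hC _ _ (fun y hy => f.zero_on_compl fun h => (hR y h).not_gt hy) fun k hk y => ?_
    refine (ContDiffMapSupportedIn.norm_iteratedFDeriv_apply_le_seminorm_top ℝ
      (f := f) (x := y)).trans ?_
    exact Seminorm.le_finset_sup_apply (p := fun i => N[ℝ; ℝ]_{K, i})
      (Finset.mem_range.2 (by omega))

/-! ### The topology of the Hölder-Besov spaces -/

theorem withSeminorms_holder (d : ℕ) (γ : ℝ) :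
    WithSeminorms (𝕜 := ℝ) (holderSeminorm d γ) := ⟨rfl⟩

instance (d : ℕ) (γ : ℝ) : IsTopologicalAddGroup (Holder d γ) :=
  (withSeminorms_holder d γ).topologicalAddGroup

theorem continuous_holderSeminorm {d : ℕ} {γ : ℝ} (K : Compacts (Rd d)) :
    Continuous (holderSeminorm d γ K) :=
  (withSeminorms_holder d γ).continuous_seminorm K

/-- A bilinear map into distributions which obeys locally a product bound is jointly continuous. -/
theorem continuous_bilinear_of_bound {d : ℕ} {γ δ : ℝ} (r : ℕ)
    (B : Holder d γ →ₗ[ℝ] Holder d δ →ₗ[ℝ] Distr d)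
    (hB : ∀ R : ℝ, ∃ (K K' : Compacts (Rd d)) (C : ℝ), 0 ≤ C ∧ ∀ f g (φ : Test d) (A : ℝ),
      (∀ y, R < ‖y‖ → φ y = 0) →
      (∀ k ≤ r, ∀ y, ‖iteratedFDeriv ℝ k (φ : Rd d → ℝ) y‖ ≤ A) →
      |B f g φ| ≤ C * holderSeminorm d γ K f * holderSeminorm d δ K' g * A) :
    Continuous fun p : Holder d γ × Holder d δ => B p.1 p.2 := by
  rw [continuous_iff_continuousAt]
  rintro ⟨f₀, g₀⟩
  refine (UniformConvergenceCLM.tendsto_iff_tendstoUniformlyOn _ _ _).2 fun S hS => ?_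
  -- Convergence in `Distr d` is uniform convergence on compact sets `S`; compactness supplies one
  -- `R` and one `A` that serve all of `S`.
  obtain ⟨R, hR⟩ := exists_common_radius hS
  choose D hD using fun k => exists_bound_iteratedFDeriv k hS
  obtain ⟨K, K', C, hC0, hC⟩ := hB R
  let A : ℝ := ∑ k ∈ Finset.range (r + 1), |D k|
  have hA : ∀ φ ∈ S, ∀ k ≤ r, ∀ y, ‖iteratedFDeriv ℝ k (φ : Rd d → ℝ) y‖ ≤ A := by
    intro φ hφ k hk y
    exact ((hD k φ hφ y).trans (le_abs_self _)).trans
      (Finset.single_le_sum (f := fun k => |D k|) (fun _ _ => abs_nonneg _)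
        (Finset.mem_range.2 (by omega)))
  have hlim : Tendsto (fun p : Holder d γ × Holder d δ =>
      C * holderSeminorm d γ K (p.1 - f₀) * holderSeminorm d δ K' p.2 * A +
      C * holderSeminorm d γ K f₀ * holderSeminorm d δ K' (p.2 - g₀) * A) (𝓝 (f₀, g₀)) (𝓝 0) := by
    have hc : Continuous (fun p : Holder d γ × Holder d δ =>
      C * holderSeminorm d γ K (p.1 - f₀) * holderSeminorm d δ K' p.2 * A +
      C * holderSeminorm d γ K f₀ * holderSeminorm d δ K' (p.2 - g₀) * A) := by
      have h1 := continuous_holderSeminorm (γ := γ) K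
      have h2 := continuous_holderSeminorm (γ := δ) K'
      have h3 := h1.comp (continuous_fst.sub (continuous_const (y := f₀)) :
        Continuous fun p : Holder d γ × Holder d δ => p.1 - f₀)
      have h4 := h2.comp (continuous_snd.sub (continuous_const (y := g₀)) :
        Continuous fun p : Holder d γ × Holder d δ => p.2 - g₀)
      have h5 := h2.comp (continuous_snd (X := Holder d γ))
      exact (((continuous_const.mul h3).mul h5).mul continuous_const).add
        ((continuous_const.mul h4).mul continuous_const)
    simpa using hc.tendsto (f₀, g₀)
  rw [Metric.tendstoUniformlyOn_iff]
  intro ε hε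
  filter_upwards [hlim.eventually (gt_mem_nhds hε)] with p hp φ hφ
  refine lt_of_le_of_lt ?_ hp
  rw [dist_comm, Real.dist_eq]
  -- The usual splitting of a difference of products. The factor in `p.2` is not bounded in advance,
  -- but its seminorm is continuous in `p`, so the majorant `hlim` still tends to zero.
  have h : B p.1 p.2 φ - B f₀ g₀ φ = B (p.1 - f₀) p.2 φ + B f₀ (p.2 - g₀) φ := by
    have e1 : B (p.1 - f₀) p.2 φ = B p.1 p.2 φ - B f₀ p.2 φ := by
      rw [map_sub]; rfl
    have e2 : B f₀ (p.2 - g₀) φ = B f₀ p.2 φ - B f₀ g₀ φ := by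
      rw [map_sub]; rfl
    rw [e1, e2]; ring
  change |B p.1 p.2 φ - B f₀ g₀ φ| ≤ _
  rw [h]
  exact (abs_add_le _ _).trans (add_le_add (hC _ _ φ A (hR φ hφ) (hA φ hφ))
    (hC _ _ φ A (hR φ hφ) (hA φ hφ)))

/-! ### Estimates by the Hölder-Besov seminorms -/

/-- A smooth function vanishing off a ball, as a test function. -/
def testOfBall (f : Rd d → ℝ) (hf : ContDiff ℝ ∞ f) (x : Rd d) (R : ℝ)
    (h : ∀ y, R < ‖y - x‖ → f y = 0) : Test d where
  toFun := f
  contDiff' := hf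
  hasCompactSupport' := HasCompactSupport.intro (isCompact_closedBall x R) fun y hy =>
    h y (by simpa [dist_eq_norm] using hy)
  tsupport_subset' := fun _ _ => trivial

@[simp] theorem testOfBall_apply (f : Rd d → ℝ) (hf : ContDiff ℝ ∞ f) (x : Rd d) (R : ℝ)
    (h : ∀ y, R < ‖y - x‖ → f y = 0) (y : Rd d) : testOfBall f hf x R h y = f y := rfl

theorem coe_testOfBall (f : Rd d → ℝ) (hf : ContDiff ℝ ∞ f) (x : Rd d) (R : ℝ)
    (h : ∀ y, R < ‖y - x‖ → f y = 0) : (testOfBall f hf x R h : Rd d → ℝ) = f := rfl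

theorem rescale_apply (φ : Test d) (x : Rd d) (l : ℝ) (hl : 0 < l) (y : Rd d) :
    rescale φ x l hl y = (l ^ d)⁻¹ * φ (l⁻¹ • (y - x)) := rfl

theorem coe_rescale (φ : Test d) (x : Rd d) (l : ℝ) (hl : 0 < l) :
    (rescale φ x l hl : Rd d → ℝ) = fun y => (l ^ d)⁻¹ * φ (l⁻¹ • (y - x)) := rfl

theorem rescale_add (φ ψ : Test d) (x : Rd d) (l : ℝ) (hl : 0 < l) :
    rescale (φ + ψ) x l hl = rescale φ x l hl + rescale ψ x l hl := by
  ext y; exact mul_add _ _ _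

theorem rescale_smul (c : ℝ) (φ : Test d) (x : Rd d) (l : ℝ) (hl : 0 < l) :
    rescale (c • φ) x l hl = c • rescale φ x l hl := by
  ext y; exact mul_left_comm _ _ _

theorem rescale_sub (φ ψ : Test d) (x : Rd d) (l : ℝ) (hl : 0 < l) :
    rescale (φ - ψ) x l hl = rescale φ x l hl - rescale ψ x l hl := by
  ext y; exact mul_sub _ _ _

theorem rescale_rescale_zero (φ : Test d) (x : Rd d) (l m : ℝ) (hl : 0 < l) (hm : 0 < m) :
    rescale (rescale φ 0 m hm) x l hl = rescale φ x (l * m) (mul_pos hl hm) := by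
  ext y
  simp only [rescale_apply, sub_zero, smul_smul, mul_pow, mul_inv]
  rw [mul_comm m⁻¹]
  ring

theorem norm_iteratedFDeriv_comp_affine {F : Type*} [NormedAddCommGroup F] [NormedSpace ℝ F]
    {f : Rd d → F} (hf : ContDiff ℝ ∞ f) (x : Rd d) {l : ℝ} (hl : 0 ≤ l) (k : ℕ) (z : Rd d) :
    ‖iteratedFDeriv ℝ k (fun z => f (x + l • z)) z‖ = l ^ k * ‖iteratedFDeriv ℝ k f (x + l • z)‖ := by
  have h1 : ContDiff ℝ k (fun z => f (x + z)) :=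
    (hf.of_le (by exact_mod_cast le_top)).comp (contDiff_const.add contDiff_id)
  rw [iteratedFDeriv_comp_const_smul l h1]
  simp only [norm_smul, iteratedFDeriv_comp_add_left, Real.norm_eq_abs, abs_pow, abs_of_nonneg hl]

theorem iteratedFDeriv_eq_zero_of_ball {F : Type*} [NormedAddCommGroup F] [NormedSpace ℝ F]
    {f : Rd d → F} {x : Rd d} {R : ℝ} (h : ∀ y, R < ‖y - x‖ → f y = 0) (k : ℕ) {y : Rd d}
    (hy : R < ‖y - x‖) : iteratedFDeriv ℝ k f y = 0 := by
  have ht : tsupport f ⊆ closedBall x R := closure_minimal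
    (fun z hz => by
      by_contra hc
      exact hz (h z (by simpa [dist_eq_norm] using hc))) isClosed_closedBall
  by_contra hc
  have := ht (support_iteratedFDeriv_subset (𝕜 := ℝ) k hc)
  rw [mem_closedBall, dist_eq_norm] at this
  linarith

theorem le_holderSeminorm (ξ : Holder d γ) (K : Compacts (Rd d)) {ψ : Test d}
    (hψ : ψ ∈ gauges γ (K : Set (Rd d))) : |ξ.toDistr ψ| ≤ holderSeminorm d γ K ξ :=
  le_ciSup (ξ.bddAbove K) ⟨ψ, hψ⟩

theorem inv_smul_mem_unitTests {φ : Test d} {r : ℕ} {A : ℝ} (hA : 0 < A)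
    (hφ : ∀ y, 1 < ‖y‖ → φ y = 0)
    (hb : ∀ k ≤ r, ∀ y, ‖iteratedFDeriv ℝ k (φ : Rd d → ℝ) y‖ ≤ A) :
    A⁻¹ • φ ∈ unitTests d r := by
  refine ⟨closure_minimal (fun z hz => ?_) isClosed_closedBall, fun k hk y => ?_⟩
  · by_contra hc
    refine hz ?_
    change A⁻¹ * φ z = 0
    rw [hφ z (by simpa using hc), mul_zero]
  · have : ((A⁻¹ • φ : Test d) : Rd d → ℝ) = A⁻¹ • (φ : Rd d → ℝ) := rfl
    rw [this, iteratedFDeriv_const_smul_apply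
      (φ.contDiff.contDiffAt.of_le (by exact_mod_cast le_top)), norm_smul, norm_inv,
      Real.norm_eq_abs, abs_of_pos hA, inv_mul_le_iff₀ hA, mul_one]
    exact hb k hk y

theorem eq_zero_of_bound {φ : Test d} (h : ∀ y, ‖iteratedFDeriv ℝ 0 (φ : Rd d → ℝ) y‖ ≤ 0) :
    φ = 0 := by
  ext y
  have := h y
  rw [norm_iteratedFDeriv_zero] at this
  exact norm_le_zero_iff.1 this

theorem abs_rescale_le (ξ : Holder d γ) (K : Compacts (Rd d)) {x : Rd d} (hx : x ∈ K) {l : ℝ}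
    (hl : 0 < l) (hl1 : l ≤ 1) {φ : Test d} {A : ℝ} (hφ : ∀ y, 1 < ‖y‖ → φ y = 0)
    (hb : ∀ k ≤ testOrder γ, ∀ y, ‖iteratedFDeriv ℝ k (φ : Rd d → ℝ) y‖ ≤ A)
    (ha : Annihilates γ φ) :
    |ξ.toDistr (rescale φ x l hl)| ≤ holderSeminorm d γ K ξ * A * l ^ γ := by
  have hA : 0 ≤ A := (norm_nonneg _).trans (hb 0 (Nat.zero_le _) 0)
  -- Membership in the gauges needs division by `A`. For `A = 0` the test function itself vanishes.
  rcases hA.eq_or_lt with rfl | hA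
  · have h0 : rescale (0 : Test d) x l hl = 0 := by ext y; exact mul_zero _
    rw [eq_zero_of_bound (hb 0 (Nat.zero_le _)), h0]
    simp
  · have hm : l ^ (-γ) • rescale (A⁻¹ • φ) x l hl ∈ gauges γ (K : Set (Rd d)) := by
      refine Or.inr ⟨A⁻¹ • φ, inv_smul_mem_unitTests hA hφ hb, fun k hk => ?_, x, hx, l, hl,
        hl1, rfl⟩
      have h : ∀ y : Rd d, (A⁻¹ • φ : Test d) y * ∏ i, y i ^ k i = A⁻¹ * (φ y * ∏ i, y i ^ k i) :=
        fun y => mul_assoc _ _ _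
      simp_rw [h]
      rw [integral_const_mul, ha k hk, mul_zero]
    have h := le_holderSeminorm ξ K hm
    rw [rescale_smul, map_smul, map_smul, smul_eq_mul, smul_eq_mul, abs_mul, abs_mul,
      abs_of_pos (Real.rpow_pos_of_pos hl _), abs_of_pos (inv_pos.2 hA), Real.rpow_neg hl.le,
      inv_mul_le_iff₀ (Real.rpow_pos_of_pos hl _), inv_mul_le_iff₀ hA] at h
    linarith

theorem abs_rescale_one_le (ξ : Holder d γ) (K : Compacts (Rd d)) {x : Rd d} (hx : x ∈ K)
    {φ : Test d} {A : ℝ} (hφ : ∀ y, 1 < ‖y‖ → φ y = 0)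
    (hb : ∀ k ≤ testOrder γ, ∀ y, ‖iteratedFDeriv ℝ k (φ : Rd d → ℝ) y‖ ≤ A) :
    |ξ.toDistr (rescale φ x 1 one_pos)| ≤ holderSeminorm d γ K ξ * A := by
  have hA : 0 ≤ A := (norm_nonneg _).trans (hb 0 (Nat.zero_le _) 0)
  rcases hA.eq_or_lt with rfl | hA
  · have h0 : rescale (0 : Test d) x 1 one_pos = 0 := by ext y; exact mul_zero _
    rw [eq_zero_of_bound (hb 0 (Nat.zero_le _)), h0]
    simp
  · have h := le_holderSeminorm ξ K (ψ := rescale (A⁻¹ • φ) x 1 one_pos)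
      (Or.inl ⟨A⁻¹ • φ, inv_smul_mem_unitTests hA hφ hb, x, hx, rfl⟩)
    rw [rescale_smul, map_smul, smul_eq_mul, abs_mul, abs_of_pos (inv_pos.2 hA),
      inv_mul_le_iff₀ hA] at h
    linarith

/-- The test function `z ↦ ψ (x + l z)`, for `ψ` supported in the `l`-ball around `x`. -/
def unscale (ψ : Test d) (x : Rd d) (l : ℝ) (hl : 0 < l) (hψ : ∀ y, l < ‖y - x‖ → ψ y = 0) :
    Test d :=
  testOfBall (fun z => ψ (x + l • z))
    (ψ.contDiff.comp (contDiff_const.add (contDiff_id.const_smul l))) 0 1 fun z hz => hψ _ <| by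
      rw [sub_zero] at hz
      rw [add_sub_cancel_left, norm_smul, Real.norm_eq_abs, abs_of_pos hl]
      exact lt_mul_of_one_lt_right hl hz

theorem rescale_unscale (ψ : Test d) (x : Rd d) (l : ℝ) (hl : 0 < l)
    (hψ : ∀ y, l < ‖y - x‖ → ψ y = 0) :
    l ^ d • rescale (unscale ψ x l hl hψ) x l hl = ψ := by
  ext y
  change l ^ d * ((l ^ d)⁻¹ * ψ (x + l • l⁻¹ • (y - x))) = ψ y
  rw [mul_inv_cancel_left₀ (pow_ne_zero _ hl.ne'), smul_inv_smul₀ hl.ne', add_sub_cancel]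

/-- Dilating by `l` multiplies the `k`-th derivative by `l ^ k`, which cancels the growth allowed at
scale `l`. -/
theorem unscale_bound {ψ : Test d} {x : Rd d} {l : ℝ} (hl : 0 < l)
    (hψ : ∀ y, l < ‖y - x‖ → ψ y = 0) {A : ℝ} {r : ℕ}
    (hb : ∀ k ≤ r, ∀ y, ‖iteratedFDeriv ℝ k (ψ : Rd d → ℝ) y‖ ≤ A * (l ^ k)⁻¹) :
    ∀ k ≤ r, ∀ y, ‖iteratedFDeriv ℝ k (unscale ψ x l hl hψ : Rd d → ℝ) y‖ ≤ A := by
  intro k hk y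
  rw [unscale, coe_testOfBall, norm_iteratedFDeriv_comp_affine ψ.contDiff x hl.le]
  have := mul_le_mul_of_nonneg_left (hb k hk (x + l • y)) (pow_nonneg hl.le k)
  rwa [mul_comm A, mul_inv_cancel_left₀ (pow_ne_zero _ hl.ne')] at this

theorem unscale_eq_zero {ψ : Test d} {x : Rd d} {l : ℝ} (hl : 0 < l)
    (hψ : ∀ y, l < ‖y - x‖ → ψ y = 0) (z : Rd d) (hz : 1 < ‖z‖) : unscale ψ x l hl hψ z = 0 := by
  refine hψ _ ?_
  rw [add_sub_cancel_left, norm_smul, Real.norm_eq_abs, abs_of_pos hl]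
  exact lt_mul_of_one_lt_right hl hz

/-- Distributions of negative regularity, tested at scale `l`. -/
theorem abs_apply_le_of_neg (hγ : γ < 0) (ξ : Holder d γ) (K : Compacts (Rd d)) {x : Rd d}
    (hx : x ∈ K) {l : ℝ} (hl : 0 < l) (hl1 : l ≤ 1) {ψ : Test d} {A : ℝ}
    (hψ : ∀ y, l < ‖y - x‖ → ψ y = 0)
    (hb : ∀ k ≤ testOrder γ, ∀ y, ‖iteratedFDeriv ℝ k (ψ : Rd d → ℝ) y‖ ≤ A * (l ^ k)⁻¹) :
    |ξ.toDistr ψ| ≤ holderSeminorm d γ K ξ * A * (l ^ d * l ^ γ) := by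
  have h := abs_rescale_le ξ K hx hl hl1 (unscale_eq_zero hl hψ) (unscale_bound hl hψ hb)
    -- The moment condition is void: a degree is nonnegative and cannot be at most `γ < 0`.
    (fun k hk => by
      have : (0 : ℝ) ≤ ((∑ i, k i : ℕ) : ℝ) := Nat.cast_nonneg _
      linarith)
  rw [← rescale_unscale ψ x l hl hψ, map_smul, smul_eq_mul, abs_mul,
    abs_of_pos (pow_pos hl d)]
  calc _ ≤ l ^ d * (holderSeminorm d γ K ξ * A * l ^ γ) := by gcongr
    _ = _ := by ring

/-- Elements of `C^γ`, tested at unit scale. -/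
theorem abs_apply_le_of_unit (ξ : Holder d γ) (K : Compacts (Rd d)) {x : Rd d}
    (hx : x ∈ K) {ψ : Test d} {A : ℝ} (hψ : ∀ y, 1 < ‖y - x‖ → ψ y = 0)
    (hb : ∀ k ≤ testOrder γ, ∀ y, ‖iteratedFDeriv ℝ k (ψ : Rd d → ℝ) y‖ ≤ A) :
    |ξ.toDistr ψ| ≤ holderSeminorm d γ K ξ * A := by
  have h := abs_rescale_one_le ξ K hx (unscale_eq_zero one_pos hψ)
    (unscale_bound one_pos hψ (by simpa using hb))
  have h2 := rescale_unscale ψ x 1 one_pos hψ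
  rw [one_pow, one_smul] at h2
  rwa [h2] at h

theorem exists_bound_derivs (φ : Test d) (r : ℕ) :
    ∃ A : ℝ, 0 ≤ A ∧ ∀ k ≤ r, ∀ y, ‖iteratedFDeriv ℝ k (φ : Rd d → ℝ) y‖ ≤ A := by
  choose C hC using fun k => exists_bound_iteratedFDeriv (F := ℝ) k (isCompact_singleton (x := φ))
  refine ⟨∑ k ∈ Finset.range (r + 1), |C k|, Finset.sum_nonneg fun _ _ => abs_nonneg _,
    fun k hk y => ?_⟩
  exact ((hC k φ rfl y).trans (le_abs_self _)).trans
    (Finset.single_le_sum (f := fun k => |C k|) (fun _ _ => abs_nonneg _)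
      (Finset.mem_range.2 (by omega)))

/-! ### Smoothness of smeared distributions -/

/-- By symmetry of the second derivative, the derivative of the first-order Taylor remainder of `f`
is the remainder of `fderiv ℝ f`. The induction thus passes to a new target space, and only the case
`k = 0` needs estimates, namely the mean value inequality for `fderiv ℝ f` and then for `f`. The
lemma makes difference quotients of test functions converge together with their derivatives. -/
theorem norm_iteratedFDeriv_taylor_le {E : Type} [NormedAddCommGroup E] [NormedSpace ℝ E] (k : ℕ) :
    ∀ {F : Type} [NormedAddCommGroup F] [NormedSpace ℝ F] {f : E → F} (_ : ContDiff ℝ ∞ f)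
      {M : ℝ} (_ : ∀ y, ‖iteratedFDeriv ℝ (k + 2) f y‖ ≤ M) (v z : E),
      ‖iteratedFDeriv ℝ k (fun z => f (z - v) - f z + fderiv ℝ f z v) z‖ ≤ M * ‖v‖ ^ 2 := by
  induction k with
  | zero =>
    intro F _ _ f hf M hM v z
    have hf' : ContDiff ℝ ∞ (fderiv ℝ f) := (contDiff_infty_iff_fderiv.1 hf).2
    have hd : Differentiable ℝ f := hf.differentiable (by simp)
    have hd' : Differentiable ℝ (fderiv ℝ f) := hf'.differentiable (by simp)
    have h2 : ∀ y, ‖fderiv ℝ (fderiv ℝ f) y‖ ≤ M := fun y => by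
      have := hM y
      rwa [zero_add, ← norm_iteratedFDeriv_fderiv, norm_iteratedFDeriv_one] at this
    have h1 : ∀ w, ‖fderiv ℝ f w - fderiv ℝ f z‖ ≤ M * ‖w - z‖ := fun w =>
      convex_univ.norm_image_sub_le_of_norm_fderiv_le (fun y _ => hd' y) (fun y _ => h2 y)
        (Set.mem_univ z) (Set.mem_univ w)
    have hM0 : 0 ≤ M := (norm_nonneg (fderiv ℝ (fderiv ℝ f) z)).trans (h2 z)
    have h := (convex_closedBall z ‖v‖).norm_image_sub_le_of_norm_hasFDerivWithin_le'
      (f := f) (f' := fderiv ℝ f) (φ := fderiv ℝ f z) (C := M * ‖v‖) (x := z) (y := z - v)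
      (fun y _ => (hd y).hasFDerivAt.hasFDerivWithinAt)
      (fun y hy => (h1 y).trans (by
        rw [mem_closedBall, dist_eq_norm] at hy
        gcongr))
      (mem_closedBall_self (norm_nonneg _)) (by simp)
    rw [norm_iteratedFDeriv_zero]
    simp only [sub_sub_cancel_left, map_neg, sub_neg_eq_add, norm_neg] at h
    rw [pow_two, ← mul_assoc]
    exact h
  | succ k ih =>
    intro F _ _ f hf M hM v z
    have hf' : ContDiff ℝ ∞ (fderiv ℝ f) := (contDiff_infty_iff_fderiv.1 hf).2
    have hd : Differentiable ℝ f := hf.differentiable (by simp)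
    have hd' : Differentiable ℝ (fderiv ℝ f) := hf'.differentiable (by simp)
    have hfd : fderiv ℝ (fun z => f (z - v) - f z + fderiv ℝ f z v) =
        fun z => fderiv ℝ f (z - v) - fderiv ℝ f z + fderiv ℝ (fderiv ℝ f) z v := by
      ext w u
      have e1 : HasFDerivAt (fun z => f (z - v)) (fderiv ℝ f (w - v)) w :=
        (hd (w - v)).hasFDerivAt.comp w ((hasFDerivAt_id w).sub_const v)
      have e2 : HasFDerivAt (fun z => fderiv ℝ f z v) ((fderiv ℝ (fderiv ℝ f) w).flip v) w := by
        simpa using (hd' w).hasFDerivAt.clm_apply (hasFDerivAt_const v w)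
      have e3 : HasFDerivAt (fun z => f (z - v) - f z + fderiv ℝ f z v) _ w :=
        (e1.sub (hd w).hasFDerivAt).add e2
      rw [e3.fderiv]
      have hs : IsSymmSndFDerivAt ℝ f w :=
        hf.contDiffAt.isSymmSndFDerivAt (by
          rw [minSmoothness_of_isRCLikeNormedField]
          exact WithTop.coe_le_coe.2 (le_top : (2 : ℕ∞) ≤ ⊤))
      change _ + fderiv ℝ (fderiv ℝ f) w u v = _ + fderiv ℝ (fderiv ℝ f) w v u
      rw [hs.eq u v]
    rw [← norm_iteratedFDeriv_fderiv, hfd]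
    refine ih hf' (fun y => ?_) v z
    rw [norm_iteratedFDeriv_fderiv]
    exact hM y

/-- The smooth function `y ↦ ξ (φ_y^l)`. -/
def smear (ξ : Distr d) (φ : Test d) (l : ℝ) (hl : 0 < l) (y : Rd d) : ℝ := ξ (rescale φ y l hl)

theorem lineDeriv_apply (φ : Test d) (v y : Rd d) : (∂_{v} φ : Test d) y = fderiv ℝ φ y v := by
  change (TestFunction.lineDerivCLM ℝ v φ : Test d) y = _
  rw [TestFunction.lineDerivCLM_eq_fderivCLM, TestFunction.fderivCLM_apply_of_le _ (by simp)]

theorem coe_lineDeriv (φ : Test d) (v : Rd d) :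
    ((∂_{v} φ : Test d) : Rd d → ℝ) = fun y => fderiv ℝ φ y v :=
  funext fun y => lineDeriv_apply φ v y

theorem lineDeriv_eq_zero {φ : Test d} {R : ℝ} (hφ : ∀ y, R < ‖y‖ → φ y = 0) (v : Rd d) :
    ∀ y, R < ‖y‖ → (∂_{v} φ : Test d) y = 0 := by
  intro y hy
  have h := iteratedFDeriv_eq_zero_of_ball (x := 0) (f := φ) (R := R) (by simpa using hφ) 1
    (y := y) (by simpa using hy)
  have h2 : ‖fderiv ℝ φ y‖ = 0 := by rw [← norm_iteratedFDeriv_one (𝕜 := ℝ), h, norm_zero]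
  rw [lineDeriv_apply, norm_eq_zero.1 h2]
  rfl

theorem norm_iteratedFDeriv_lineDeriv_le (φ : Test d) (v : Rd d) (j : ℕ) (y : Rd d) :
    ‖iteratedFDeriv ℝ j (∂_{v} φ : Test d) y‖ ≤
      ‖v‖ * ‖iteratedFDeriv ℝ (j + 1) (φ : Rd d → ℝ) y‖ := by
  have hf' : ContDiff ℝ ∞ (fderiv ℝ φ) := (contDiff_infty_iff_fderiv.1 φ.contDiff).2
  rw [coe_lineDeriv, ← norm_iteratedFDeriv_fderiv]
  exact norm_iteratedFDeriv_clm_apply_const hf'.contDiffAt (by exact_mod_cast le_top)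

theorem integrable_test_mul (φ : Test d) {G : Rd d → ℝ} (hG : Continuous G) :
    Integrable fun y => φ y * G y :=
  (φ.continuous.mul hG).integrable_of_hasCompactSupport φ.hasCompactSupport.mul_right

/-- Integration by parts moves the derivative onto the monomial, where it yields a combination of
monomials of lower degree, which `φ` annihilates as well. -/
theorem annihilates_lineDeriv {φ : Test d} (hφ : Annihilates γ φ) (v : Rd d) :
    Annihilates γ (∂_{v} φ : Test d) := by
  intro k hk
  let G : Rd d → ℝ := fun y => ∏ i, y i ^ k i
  let G' : Rd d → Rd d →L[ℝ] ℝ := fun y => ∑ i, (∏ j ∈ Finset.univ.erase i, y j ^ k j) •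
    ((k i * y i ^ (k i - 1)) • (EuclideanSpace.proj i : Rd d →L[ℝ] ℝ))
  have hG : ∀ y, HasFDerivAt G (G' y) y := fun y =>
    HasFDerivAt.finsetProd (u := Finset.univ) (g := fun i (y : Rd d) => y i ^ k i) fun i _ => by
      have h1 : HasFDerivAt (fun y : Rd d => y i) (EuclideanSpace.proj i : Rd d →L[ℝ] ℝ) y :=
        (EuclideanSpace.proj i : Rd d →L[ℝ] ℝ).hasFDerivAt
      simpa using h1.pow (k i)
  have hcG : Continuous G := by fun_prop
  have hcG' : ∀ i, Continuous fun y : Rd d =>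
      (∏ j ∈ Finset.univ.erase i, y j ^ k j) * (k i * y i ^ (k i - 1)) := by
    intro i; fun_prop
  have hGv : ∀ y, φ y * fderiv ℝ G y v = ∑ i, v i * (φ y *
      ((∏ j ∈ Finset.univ.erase i, y j ^ k j) * (k i * y i ^ (k i - 1)))) := by
    intro y
    rw [(hG y).fderiv]
    simp only [G', sum_apply, Finset.mul_sum]
    refine Finset.sum_congr rfl fun i _ => ?_
    simp
    ring
  have hterm : ∀ i, ∫ y, φ y *
      ((∏ j ∈ Finset.univ.erase i, y j ^ k j) * (k i * y i ^ (k i - 1))) = 0 := by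
    intro i
    -- If `k i = 0`, the truncated exponent `k i - 1` is harmless because the coefficient `k i`
    -- vanishes.
    by_cases hki : k i = 0
    · simp [hki]
    · have h := hφ (Function.update k i (k i - 1)) (le_trans (by
        exact_mod_cast Finset.sum_le_sum fun j _ => by
          by_cases hj : j = i
          · subst hj; simp
          · simp [hj]) hk)
      have e : ∀ y : Rd d, φ y * ((∏ j ∈ Finset.univ.erase i, y j ^ k j) *
          (k i * y i ^ (k i - 1))) =
          k i * (φ y * ∏ j, y j ^ (Function.update k i (k i - 1) j)) := by
        intro y
        rw [← Finset.prod_erase_mul _ _ (Finset.mem_univ i)]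
        have : ∏ j ∈ Finset.univ.erase i, y j ^ (Function.update k i (k i - 1) j) =
            ∏ j ∈ Finset.univ.erase i, y j ^ k j :=
          Finset.prod_congr rfl fun j hj => by
            rw [Function.update_of_ne (Finset.ne_of_mem_erase hj)]
        rw [this, Function.update_self]
        ring
      simp_rw [e]
      rw [integral_const_mul, h, mul_zero]
  have hibp := integral_mul_fderiv_eq_neg_fderiv_mul_of_integrable (μ := volume) (𝕜 := ℝ)
    (f := (φ : Rd d → ℝ)) (g := G) (v := v)
    (by
      have := integrable_test_mul (∂_{v} φ : Test d) hcG
      simpa only [lineDeriv_apply] using this)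
    (by
      simp_rw [hGv]
      exact integrable_finsetSum _ fun i _ => (integrable_test_mul φ (hcG' i)).const_mul _)
    (integrable_test_mul φ hcG)
    (fun y _ => (φ.contDiff.differentiable (by simp)) y) (fun y _ => (hG y).differentiableAt)
  simp_rw [hGv] at hibp
  rw [integral_finsetSum _ fun i _ => (integrable_test_mul φ (hcG' i)).const_mul _] at hibp
  simp_rw [integral_const_mul, hterm] at hibp
  simp only [mul_zero, Finset.sum_const_zero, zero_eq_neg] at hibp
  simpa only [lineDeriv_apply] using hibp

theorem coe_rescale_add (φ : Test d) (y v : Rd d) (l : ℝ) (hl : 0 < l) (z : Rd d) :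
    rescale φ (y + v) l hl z = rescale φ y l hl (z - v) := by
  rw [rescale_apply, rescale_apply, sub_sub, add_comm y v]

theorem fderiv_rescale (φ : Test d) (y v : Rd d) (l : ℝ) (hl : 0 < l) (z : Rd d) :
    fderiv ℝ (rescale φ y l hl) z v = l⁻¹ * rescale (∂_{v} φ) y l hl z := by
  have h1 : HasFDerivAt (fun z : Rd d => l⁻¹ • (z - y)) (l⁻¹ • ContinuousLinearMap.id ℝ (Rd d)) z :=
    ((hasFDerivAt_id z).sub_const y).const_smul l⁻¹
  have h2 := ((((φ.contDiff.differentiable (by simp)) (l⁻¹ • (z - y))).hasFDerivAt.comp z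
    h1).const_mul (l ^ d)⁻¹)
  rw [coe_rescale]
  erw [h2.fderiv]
  rw [rescale_apply, lineDeriv_apply]
  simp
  ring

theorem rescale_eq_zero {φ : Test d} {R : ℝ} (hφ : ∀ y, R < ‖y‖ → φ y = 0) {y : Rd d} {l : ℝ}
    (hl : 0 < l) {z : Rd d} (hz : l * R < ‖z - y‖) : rescale φ y l hl z = 0 := by
  rw [rescale_apply, hφ, mul_zero]
  rw [norm_smul, norm_inv, Real.norm_eq_abs, abs_of_pos hl, inv_mul_eq_div, lt_div_iff₀ hl]
  linarith

/-- The error of the first-order expansion in `v` is `ξ` applied to a Taylor remainder whose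
derivatives are `O(‖v‖ ^ 2)`. As `φ` lives in the ball of radius `1/2` and `l ≤ 1`, this remainder
stays in the unit ball around `y` when `‖v‖ ≤ 1/2`. The unit-scale part of the seminorm therefore
controls it, and no moment condition is needed. -/
theorem hasFDerivAt_smear (ξ : Holder d γ) {φ : Test d} (hφ : ∀ y, 1 / 2 < ‖y‖ → φ y = 0) {l : ℝ}
    (hl : 0 < l) (hl1 : l ≤ 1) (y : Rd d) :
    ∃ L : Rd d →L[ℝ] ℝ, HasFDerivAt (smear ξ.toDistr φ l hl) L y ∧
      ∀ v, L v = -l⁻¹ * smear ξ.toDistr (∂_{v} φ) l hl y := by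
  let L₀ : Rd d →ₗ[ℝ] ℝ :=
    { toFun := fun v => -l⁻¹ * smear ξ.toDistr (∂_{v} φ) l hl y
      map_add' := fun v w => by
        simp only [smear]
        rw [LineDeriv.lineDerivOp_left_add, rescale_add, map_add, mul_add]
      map_smul' := fun c v => by
        simp only [smear]
        rw [LineDeriv.lineDerivOp_left_smul, rescale_smul, map_smul, smul_eq_mul, smul_eq_mul,
          RingHom.id_apply]
        ring }
  refine ⟨LinearMap.toContinuousLinearMap L₀, ?_, fun v => rfl⟩
  rw [hasFDerivAt_iff_isLittleO_nhds_zero]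
  let u : Test d := rescale φ y l hl
  obtain ⟨A, hA0, hA⟩ := exists_bound_derivs u (testOrder γ + 2)
  let K : Compacts (Rd d) := ⟨{y}, isCompact_singleton⟩
  have hbig : (fun v => smear ξ.toDistr φ l hl (y + v) - smear ξ.toDistr φ l hl y -
      LinearMap.toContinuousLinearMap L₀ v) =O[𝓝 0] fun v : Rd d => ‖v‖ ^ 2 := by
    refine Asymptotics.IsBigO.of_bound (holderSeminorm d γ K ξ * A) ?_
    filter_upwards [closedBall_mem_nhds (0 : Rd d) (by norm_num : (0 : ℝ) < 1 / 2)] with v hv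
    rw [mem_closedBall_zero_iff] at hv
    let ψ : Test d := rescale φ (y + v) l hl - u + l⁻¹ • rescale (∂_{v} φ) y l hl
    have hψ : (ψ : Rd d → ℝ) = fun z => u (z - v) - u z + fderiv ℝ u z v := by
      ext z
      change rescale φ (y + v) l hl z - u z + l⁻¹ * rescale (∂_{v} φ) y l hl z = _
      rw [coe_rescale_add, fderiv_rescale]
    have hsupp : ∀ z, 1 < ‖z - y‖ → ψ z = 0 := by
      intro z hz
      change rescale φ (y + v) l hl z - rescale φ y l hl z +
        l⁻¹ * rescale (∂_{v} φ) y l hl z = 0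
      have h3 : ‖z - y‖ ≤ ‖z - (y + v)‖ + ‖v‖ := by
        have := norm_add_le (z - (y + v)) v
        rwa [show z - (y + v) + v = z - y by abel] at this
      rw [rescale_eq_zero hφ hl (by linarith), rescale_eq_zero hφ hl (by linarith),
        rescale_eq_zero (lineDeriv_eq_zero hφ v) hl (by linarith)]
      simp
    have h := abs_apply_le_of_unit ξ K (x := y) rfl (ψ := ψ) (A := A * ‖v‖ ^ 2) hsupp
      (fun k hk z => by
        rw [hψ]
        exact norm_iteratedFDeriv_taylor_le k u.contDiff (hA (k + 2) (by omega)) v z)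
    have e : smear ξ.toDistr φ l hl (y + v) - smear ξ.toDistr φ l hl y -
      LinearMap.toContinuousLinearMap L₀ v = ξ.toDistr ψ := by
      change ξ.toDistr (rescale φ (y + v) l hl) - ξ.toDistr u -
        -l⁻¹ * ξ.toDistr (rescale (∂_{v} φ) y l hl) = ξ.toDistr
          (rescale φ (y + v) l hl - u + l⁻¹ • rescale (∂_{v} φ) y l hl)
      rw [map_add, map_sub, map_smul, smul_eq_mul]
      ring
    rw [e, Real.norm_eq_abs, norm_pow, norm_norm, mul_assoc]
    exact h
  exact hbig.trans_isLittleO (Asymptotics.isLittleO_norm_pow_id one_lt_two)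

/-- Each directional derivative is again a smearing, with a kernel supported in the same ball, so
the induction runs over all kernels `φ` at once. -/
theorem contDiff_smear (ξ : Holder d γ) {φ : Test d} (hφ : ∀ y, 1 / 2 < ‖y‖ → φ y = 0) {l : ℝ}
    (hl : 0 < l) (hl1 : l ≤ 1) : ContDiff ℝ ∞ (smear ξ.toDistr φ l hl) := by
  rw [contDiff_infty]
  intro n
  induction n generalizing φ with
  | zero =>
    refine contDiff_zero.2 (continuous_iff_continuousAt.2 fun y => ?_)
    obtain ⟨L, hL, -⟩ := hasFDerivAt_smear ξ hφ hl hl1 y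
    exact hL.continuousAt
  | succ n ih =>
    have hn : ((n + 1 : ℕ) : ℕ∞ω) = n + 1 := by norm_cast
    rw [hn, contDiff_succ_iff_fderiv_apply]
    refine ⟨fun y => ?_, by simp, fun v => ?_⟩
    · obtain ⟨L, hL, -⟩ := hasFDerivAt_smear ξ hφ hl hl1 y
      exact hL.differentiableAt
    · have h : (fun y => fderiv ℝ (smear ξ.toDistr φ l hl) y v) =
          fun y => -l⁻¹ * smear ξ.toDistr (∂_{v} φ) l hl y := by
        funext y
        obtain ⟨L, hL, hL'⟩ := hasFDerivAt_smear ξ hφ hl hl1 y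
        rw [hL.fderiv, hL']
      rw [h]
      exact contDiff_const.mul (ih (lineDeriv_eq_zero hφ v))

theorem iteratedLineDeriv_eq_zero {φ : Test d} {R : ℝ} (hφ : ∀ y, R < ‖y‖ → φ y = 0) {k : ℕ}
    (m : Fin k → Rd d) : ∀ y, R < ‖y‖ → (∂^{m} φ : Test d) y = 0 := by
  induction k with
  | zero => simpa using hφ
  | succ k ih =>
    rw [LineDeriv.iteratedLineDerivOp_succ_left]
    exact lineDeriv_eq_zero (ih _) _

theorem annihilates_iteratedLineDeriv {φ : Test d} (hφ : Annihilates γ φ) {k : ℕ}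
    (m : Fin k → Rd d) : Annihilates γ (∂^{m} φ : Test d) := by
  induction k with
  | zero => simpa using hφ
  | succ k ih =>
    rw [LineDeriv.iteratedLineDerivOp_succ_left]
    exact annihilates_lineDeriv (ih _) _

theorem norm_iteratedFDeriv_iteratedLineDeriv_le (φ : Test d) {k : ℕ} (m : Fin k → Rd d) (j : ℕ)
    (y : Rd d) : ‖iteratedFDeriv ℝ j (∂^{m} φ : Test d) y‖ ≤
      (∏ i, ‖m i‖) * ‖iteratedFDeriv ℝ (j + k) (φ : Rd d → ℝ) y‖ := by
  induction k generalizing j with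
  | zero => simp
  | succ k ih =>
    rw [LineDeriv.iteratedLineDerivOp_succ_left, Fin.prod_univ_succ, mul_assoc]
    refine (norm_iteratedFDeriv_lineDeriv_le _ _ _ _).trans ?_
    gcongr
    refine (ih (Fin.tail m) (j + 1)).trans_eq ?_
    rw [show j + 1 + k = j + (k + 1) by ring]
    rfl

theorem iteratedFDeriv_smear_apply (ξ : Holder d γ) {φ : Test d}
    (hφ : ∀ y, 1 / 2 < ‖y‖ → φ y = 0) {l : ℝ} (hl : 0 < l) (hl1 : l ≤ 1) {k : ℕ} (y : Rd d)
    (m : Fin k → Rd d) : iteratedFDeriv ℝ k (smear ξ.toDistr φ l hl) y m =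
      (-l⁻¹) ^ k * smear ξ.toDistr (∂^{m} φ) l hl y := by
  induction k generalizing y with
  | zero => simp
  | succ k ih =>
    have hdiff : Differentiable ℝ (iteratedFDeriv ℝ k (smear ξ.toDistr φ l hl)) :=
      (contDiff_smear ξ hφ hl hl1).differentiable_iteratedFDeriv
        (by exact_mod_cast WithTop.coe_lt_top k)
    rw [(hdiff y).iteratedFDeriv_succ_apply_left']
    simp_rw [ih]
    obtain ⟨L, hL, hL'⟩ := hasFDerivAt_smear ξ (iteratedLineDeriv_eq_zero hφ (Fin.tail m)) hl hl1 y
    rw [(hL.const_mul _).fderiv, LineDeriv.iteratedLineDerivOp_succ_left]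
    change _ * L (m 0) = _
    rw [hL', pow_succ]
    ring

/-- The `k` derivatives land on the kernel: each costs `l⁻¹` and one more bounded derivative of `φ`,
while the annihilation that yields `l ^ γ` survives. -/
theorem norm_iteratedFDeriv_smear_le (ξ : Holder d γ) (K : Compacts (Rd d)) {φ : Test d}
    (hφ : ∀ y, 1 / 2 < ‖y‖ → φ y = 0) (ha : Annihilates γ φ) {l : ℝ} (hl : 0 < l) (hl1 : l ≤ 1)
    {k : ℕ} {A : ℝ}
    (hA : ∀ j ≤ testOrder γ + k, ∀ y, ‖iteratedFDeriv ℝ j (φ : Rd d → ℝ) y‖ ≤ A)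
    {y : Rd d} (hy : y ∈ K) :
    ‖iteratedFDeriv ℝ k (smear ξ.toDistr φ l hl) y‖ ≤
      holderSeminorm d γ K ξ * A * l ^ γ * (l ^ k)⁻¹ := by
  have hA0 : 0 ≤ A := (norm_nonneg _).trans (hA 0 (Nat.zero_le _) 0)
  refine ContinuousMultilinearMap.opNorm_le_bound (by positivity) fun m => ?_
  rw [iteratedFDeriv_smear_apply ξ hφ hl hl1, Real.norm_eq_abs, abs_mul, abs_pow, abs_neg, abs_inv,
    abs_of_pos hl, inv_pow]
  have h := abs_rescale_le ξ K hy hl hl1 (φ := ∂^{m} φ) (A := (∏ i, ‖m i‖) * A)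
    (fun z hz => iteratedLineDeriv_eq_zero hφ m z (by linarith))
    (fun j hj z => (norm_iteratedFDeriv_iteratedLineDeriv_le φ m j z).trans (by
      gcongr
      exact hA _ (by omega) z)) (annihilates_iteratedLineDeriv ha m)
  calc _ ≤ (l ^ k)⁻¹ * (holderSeminorm d γ K ξ * ((∏ i, ‖m i‖) * A) * l ^ γ) := by gcongr; exact h
    _ = _ := by ring

/-- Without a moment condition, this applies to the mollifier itself, whose integral is one; it
serves the coarse term. -/
theorem norm_iteratedFDeriv_smear_one_le (ξ : Holder d γ) (K : Compacts (Rd d)) {φ : Test d}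
    (hφ : ∀ y, 1 / 2 < ‖y‖ → φ y = 0) {k : ℕ} {A : ℝ}
    (hA : ∀ j ≤ testOrder γ + k, ∀ y, ‖iteratedFDeriv ℝ j (φ : Rd d → ℝ) y‖ ≤ A)
    {y : Rd d} (hy : y ∈ K) :
    ‖iteratedFDeriv ℝ k (smear ξ.toDistr φ 1 one_pos) y‖ ≤ holderSeminorm d γ K ξ * A := by
  have hA0 : 0 ≤ A := (norm_nonneg _).trans (hA 0 (Nat.zero_le _) 0)
  refine ContinuousMultilinearMap.opNorm_le_bound (by positivity) fun m => ?_
  rw [iteratedFDeriv_smear_apply ξ hφ one_pos le_rfl, Real.norm_eq_abs, abs_mul, abs_pow, abs_neg,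
    abs_inv, abs_one, inv_one, one_pow, one_mul]
  have h := abs_rescale_one_le ξ K hy (φ := ∂^{m} φ) (A := (∏ i, ‖m i‖) * A)
    (fun z hz => iteratedLineDeriv_eq_zero hφ m z (by linarith))
    (fun j hj z => (norm_iteratedFDeriv_iteratedLineDeriv_le φ m j z).trans (by
      gcongr
      exact hA _ (by omega) z))
  exact h.trans_eq (by ring)

/-! ### Partition of unity at a given scale -/

theorem norm_le_of_coord_le {z : Rd d} {a : ℝ} (h : ∀ i, |z i| ≤ a) (ha : 0 ≤ a) :
    ‖z‖ ≤ (d + 1) * a := by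
  refine abs_le_of_sq_le_sq' ?_ (by positivity) |>.2
  rw [EuclideanSpace.real_norm_sq_eq]
  calc ∑ i, z i ^ 2 ≤ ∑ _i : Fin d, a ^ 2 := Finset.sum_le_sum fun i _ => sq_le_sq' (by
        linarith [neg_abs_le (z i), h i]) ((le_abs_self _).trans (h i))
    _ = d * a ^ 2 := by simp
    _ ≤ _ := by nlinarith [sq_nonneg a, (Nat.cast_nonneg d : (0 : ℝ) ≤ d),
        mul_nonneg (Nat.cast_nonneg d : (0 : ℝ) ≤ d) (sq_nonneg a),
        mul_nonneg (sq_nonneg (d : ℝ)) (sq_nonneg a)]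

/-- Lattice points, shifted so that the origin is in the centre of the cube. -/
def latticePoint (N : ℕ) (j : Fin d → ℕ) : Rd d := WithLp.toLp 2 fun i => (j i : ℝ) - N

/-- In one variable, the bump `S t - S (t - 1)` built from a smooth step `S` has integer translates
that telescope to one; tensor products carry this to dimension `d`. -/
theorem exists_partition (d : ℕ) : ∃ (s : ℝ) (χ : Test d), 0 < s ∧ (∀ y, 1 < ‖y‖ → χ y = 0) ∧
    ∀ (N : ℕ) (y : Rd d), (∀ i, |s * y i| ≤ N - 1) →
      ∑ j ∈ Fintype.piFinset (fun _ : Fin d => Finset.range (2 * N)),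
        χ (y - s⁻¹ • latticePoint N j) = 1 := by
  -- The one-variable bump vanishes for `|t| > 2`, so on the support the coordinates are at most `2
  -- / s = 1 / (d + 1)` and the norm is at most one.
  let s : ℝ := 2 * (d + 1)
  have hs : 0 < s := by positivity
  let S := Real.smoothTransition
  let b : ℝ → ℝ := fun t => S t - S (t - 1)
  have hbsm : ContDiff ℝ ∞ b :=
    Real.smoothTransition.contDiff.sub (Real.smoothTransition.contDiff.comp
      (contDiff_id.sub contDiff_const))
  have hb0 : ∀ t, b t ≠ 0 → |t| ≤ 2 := by
    intro t ht
    by_contra hc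
    rw [not_le, lt_abs] at hc
    refine ht ?_
    rcases hc with hc | hc
    · simp only [b, S]
      rw [Real.smoothTransition.one_of_one_le (by linarith),
        Real.smoothTransition.one_of_one_le (by linarith), sub_self]
    · simp only [b, S]
      rw [Real.smoothTransition.zero_of_nonpos (by linarith),
        Real.smoothTransition.zero_of_nonpos (by linarith), sub_self]
  have hzero : ∀ y : Rd d, 1 < ‖y‖ → ∏ i, b (s * y i) = 0 := by
    intro y hy
    by_contra hc
    have hc' := Finset.prod_ne_zero_iff.1 hc
    have h := norm_le_of_coord_le (z := y) (a := 2 / s) (fun i => by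
      have := hb0 _ (hc' i (Finset.mem_univ i))
      rw [abs_mul, abs_of_pos hs] at this
      rw [le_div_iff₀ hs]; linarith) (by positivity)
    have h2 : ((d : ℝ) + 1) * (2 / s) = 1 := by
      simp only [s]; field_simp
    linarith
  let χ : Test d := testOfBall (fun y => ∏ i, b (s * y i))
    (contDiff_prod fun i _ => hbsm.comp (contDiff_const.mul
      (EuclideanSpace.proj i : Rd d →L[ℝ] ℝ).contDiff)) 0 1 (by simpa using hzero)
  refine ⟨s, χ, hs, hzero, fun N y hy => ?_⟩
  have e : ∀ j : Fin d → ℕ, χ (y - s⁻¹ • latticePoint N j) =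
      ∏ i, (S (s * y i + N - (j i : ℕ)) - S (s * y i + N - ((j i + 1 : ℕ) : ℝ))) := by
    intro j
    change ∏ i, b (s * (y - s⁻¹ • latticePoint N j : Rd d) i) = _
    refine Finset.prod_congr rfl fun i _ => ?_
    have : s * (y - s⁻¹ • latticePoint N j : Rd d) i = s * y i + N - (j i : ℕ) := by
      simp [latticePoint, mul_sub, mul_inv_cancel_left₀ hs.ne']
      ring
    simp only [b]
    rw [this]
    push_cast
    rw [sub_sub]
  simp_rw [e]
  rw [← Finset.prod_univ_sum (fun _ : Fin d => Finset.range (2 * N))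
    (fun i (n : ℕ) => S (s * y i + N - (n : ℕ)) - S (s * y i + N - ((n + 1 : ℕ) : ℝ)))]
  refine Finset.prod_eq_one fun i _ => ?_
  -- What remains is `S (t + N) - S (t - N)` with `t = s * y i`; as `|t| ≤ N - 1`, the two values
  -- are one and zero.
  rw [Finset.sum_range_sub' (fun n : ℕ => S (s * y i + N - (n : ℕ)))]
  have h := abs_le.1 (hy i)
  simp only [S]
  rw [Real.smoothTransition.one_of_one_le (by push_cast; linarith),
    Real.smoothTransition.zero_of_nonpos (by push_cast; linarith), sub_zero]

/-! ### Multiplication by smooth functions -/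

/-- The product of a test function with a smooth function. -/
def mulTest (h : Rd d → ℝ) (hh : ContDiff ℝ ∞ h) (φ : Test d) : Test d where
  toFun y := h y * φ y
  contDiff' := hh.mul φ.contDiff
  hasCompactSupport' := φ.hasCompactSupport.mul_left
  tsupport_subset' := fun _ _ => trivial

theorem mulTest_apply (h : Rd d → ℝ) (hh : ContDiff ℝ ∞ h) (φ : Test d) (y : Rd d) :
    mulTest h hh φ y = h y * φ y := rfl

theorem mulTest_eq_zero {h : Rd d → ℝ} {hh : ContDiff ℝ ∞ h} {φ : Test d} {y : Rd d}
    (hy : φ y = 0) : mulTest h hh φ y = 0 := by rw [mulTest_apply, hy, mul_zero]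

/-- In the Leibniz formula the powers `l ^ i` and `l ^ (k - i)` recombine to `l ^ k`, and the
binomial coefficients sum to `2 ^ k`. -/
theorem norm_iteratedFDeriv_mulTest_le {h : Rd d → ℝ} (hh : ContDiff ℝ ∞ h) (φ : Test d)
    {F G l : ℝ} (hl : 0 < l) {r : ℕ} {y : Rd d}
    (hF : ∀ k ≤ r, ‖iteratedFDeriv ℝ k h y‖ ≤ F * (l ^ k)⁻¹)
    (hG : ∀ k ≤ r, ‖iteratedFDeriv ℝ k (φ : Rd d → ℝ) y‖ ≤ G * (l ^ k)⁻¹) {k : ℕ} (hk : k ≤ r) :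
    ‖iteratedFDeriv ℝ k (mulTest h hh φ : Rd d → ℝ) y‖ ≤ 2 ^ r * F * G * (l ^ k)⁻¹ := by
  have hF0 : 0 ≤ F := by simpa using (norm_nonneg _).trans (hF 0 (Nat.zero_le _))
  have hG0 : 0 ≤ G := by simpa using (norm_nonneg _).trans (hG 0 (Nat.zero_le _))
  refine (norm_iteratedFDeriv_mul_le hh φ.contDiff y (by exact_mod_cast le_top)).trans ?_
  calc _ ≤ ∑ i ∈ Finset.range (k + 1), (k.choose i : ℝ) * (F * G * (l ^ k)⁻¹) := by
        refine Finset.sum_le_sum fun i hi => ?_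
        have hik : i ≤ k := by simpa [Nat.lt_succ_iff] using hi
        rw [mul_assoc]
        refine mul_le_mul_of_nonneg_left ?_ (Nat.cast_nonneg _)
        refine (mul_le_mul (hF i (by omega)) (hG (k - i) (by omega)) (norm_nonneg _)
          (by positivity)).trans_eq ?_
        have : l ^ k = l ^ i * l ^ (k - i) := by rw [← pow_add, Nat.add_sub_cancel' hik]
        rw [this, mul_inv]
        ring
    _ = 2 ^ k * (F * G * (l ^ k)⁻¹) := by
        rw [← Finset.sum_mul]
        congr 1
        exact_mod_cast Nat.sum_range_choose k
    _ ≤ 2 ^ r * (F * G * (l ^ k)⁻¹) := by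
        gcongr
        norm_num
    _ = _ := by ring

/-- Distributions of negative regularity tested against functions on a ball that oscillate at
scale `l`. -/
theorem exists_bound_of_scale (d : ℕ) (hγ : γ < 0) (R : ℝ) :
    ∃ (K : Compacts (Rd d)) (C : ℝ), 0 ≤ C ∧ ∀ (ξ : Holder d γ) (l : ℝ), 0 < l → l ≤ 1 →
      ∀ (ψ : Test d) (A : ℝ), (∀ y, R < ‖y‖ → ψ y = 0) →
      (∀ k ≤ testOrder γ, ∀ y, ‖iteratedFDeriv ℝ k (ψ : Rd d → ℝ) y‖ ≤ A * (l ^ k)⁻¹) →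
      |ξ.toDistr ψ| ≤ C * holderSeminorm d γ K ξ * A * l ^ γ := by
  obtain ⟨s, χ, hs, hχ, hsum⟩ := exists_partition d
  obtain ⟨D, hD0, hD⟩ := exists_bound_derivs χ (testOrder γ)
  let ρ : ℝ := s * |R| + 2
  have hρ : 0 < ρ := by positivity
  let K : Compacts (Rd d) := ⟨closedBall 0 ((d + 1) * (ρ / s)), isCompact_closedBall _ _⟩
  refine ⟨K, (2 * ρ) ^ d * (2 ^ testOrder γ * D), by positivity, ?_⟩
  intro ξ l hl hl1 ψ A hψ hA
  have hA0 : 0 ≤ A := by simpa using (norm_nonneg _).trans (hA 0 (Nat.zero_le _) 0)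
  -- Large enough for the translates to cover the ball of radius `R` after rescaling by `l`, while
  -- `N * l ≤ ρ` uniformly in `l`. The latter confines the centres to `K` and bounds the number of
  -- bumps `(2 * N) ^ d` by `(2 * ρ) ^ d * l ^ (-d)`.
  let N : ℕ := ⌈s * |R| / l⌉₊ + 1
  have hN1 : s * |R| / l ≤ N - 1 := by
    have := Nat.le_ceil (s * |R| / l)
    simp only [N]; push_cast; linarith
  have hN2 : (N : ℝ) * l ≤ ρ := by
    have := (Nat.ceil_lt_add_one (by positivity : 0 ≤ s * |R| / l)).le
    have h2 : (N : ℝ) ≤ s * |R| / l + 2 := by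
      simp only [N]; push_cast; linarith
    calc (N : ℝ) * l ≤ (s * |R| / l + 2) * l := by gcongr
      _ = s * |R| + 2 * l := by field_simp
      _ ≤ ρ := by simp only [ρ]; linarith
  let x : (Fin d → ℕ) → Rd d := fun j => l • s⁻¹ • latticePoint N j
  let I := Fintype.piFinset (fun _ : Fin d => Finset.range (2 * N))
  have hx : ∀ j ∈ I, x j ∈ K := by
    intro j hj
    change x j ∈ closedBall 0 _
    rw [mem_closedBall_zero_iff]
    refine norm_le_of_coord_le (fun i => ?_) (by positivity)
    have hji : j i < 2 * N := Finset.mem_range.1 (Fintype.mem_piFinset.1 hj i)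
    have hji' : (j i : ℝ) ≤ 2 * N := by exact_mod_cast hji.le
    have : |(j i : ℝ) - N| ≤ N := abs_le.2
      ⟨by linarith [Nat.cast_nonneg (α := ℝ) (j i)], by linarith⟩
    have e : x j i = l * (s⁻¹ * ((j i : ℝ) - N)) := by simp [x, latticePoint]
    rw [e, abs_mul, abs_mul, abs_of_pos hl, abs_of_pos (inv_pos.2 hs)]
    calc l * (s⁻¹ * |(j i : ℝ) - N|) ≤ l * (s⁻¹ * N) := by gcongr
      _ = (N * l) / s := by field_simp
      _ ≤ ρ / s := by gcongr
  let w : (Fin d → ℕ) → Rd d → ℝ := fun j y => χ (-(l⁻¹ • x j) + l⁻¹ • y)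
  have hw : ∀ j, ContDiff ℝ ∞ (w j) := fun j =>
    χ.contDiff.comp (contDiff_const.add (contDiff_id.const_smul l⁻¹))
  have hdec : ψ = ∑ j ∈ I, mulTest (w j) (hw j) ψ := by
    ext y
    have hs : (∑ j ∈ I, mulTest (w j) (hw j) ψ : Test d) y = ∑ j ∈ I, w j y * ψ y := by
      rw [sum_apply]
      rfl
    rw [hs, ← Finset.sum_mul]
    by_cases hy : ‖y‖ ≤ R
    · have h1 := hsum N (l⁻¹ • y) (fun i => by
        have hyi : |y i| ≤ |R| := ((PiLp.norm_apply_le y i).trans hy).trans (le_abs_self R)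
        refine le_trans ?_ hN1
        rw [PiLp.smul_apply, smul_eq_mul, abs_mul, abs_mul, abs_of_pos ‹0 < s›, abs_inv,
          abs_of_pos hl]
        rw [div_eq_mul_inv, mul_assoc, mul_comm l⁻¹]
        gcongr)
      have h2 : ∑ j ∈ I, w j y = 1 := by
        rw [← h1]
        refine Finset.sum_congr rfl fun j _ => ?_
        simp only [w, x]
        rw [inv_smul_smul₀ hl.ne', neg_add_eq_sub]
      rw [h2, one_mul]
    · rw [hψ y (not_le.1 hy), mul_zero]
  have hterm : ∀ j ∈ I, |ξ.toDistr (mulTest (w j) (hw j) ψ)| ≤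
      holderSeminorm d γ K ξ * (2 ^ testOrder γ * D * A) * (l ^ d * l ^ γ) := by
    intro j hj
    refine abs_apply_le_of_neg hγ ξ K (hx j hj) hl hl1 (fun y hy => ?_) fun k hk y => ?_
    · rw [mulTest_apply]
      have : w j y = 0 := by
        refine hχ _ ?_
        rw [neg_add_eq_sub, ← smul_sub, norm_smul, norm_inv, Real.norm_eq_abs, abs_of_pos hl,
          inv_mul_eq_div, one_lt_div hl]
        exact hy
      rw [this, zero_mul]
    · refine norm_iteratedFDeriv_mulTest_le (hw j) ψ hl (fun i hi => ?_) (fun i hi => hA i hi y) hk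
      rw [norm_iteratedFDeriv_comp_affine χ.contDiff _ (inv_pos.2 hl).le, inv_pow, mul_comm]
      gcongr
      exact hD i hi _
  rw [hdec, map_sum]
  -- The factor `l ^ d` gained on each bump compensates for their number.
  calc |∑ j ∈ I, ξ.toDistr (mulTest (w j) (hw j) ψ)|
      ≤ ∑ j ∈ I, |ξ.toDistr (mulTest (w j) (hw j) ψ)| := Finset.abs_sum_le_sum_abs _ _
    _ ≤ ∑ _j ∈ I, holderSeminorm d γ K ξ * (2 ^ testOrder γ * D * A) * (l ^ d * l ^ γ) :=
        Finset.sum_le_sum hterm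
    _ = (2 * (N * l)) ^ d * (2 ^ testOrder γ * D) * holderSeminorm d γ K ξ * A * l ^ γ := by
        rw [Finset.sum_const, nsmul_eq_mul, Fintype.card_piFinset_const, Finset.card_range]
        push_cast
        simp only [mul_pow]
        ring
    _ ≤ (2 * ρ) ^ d * (2 ^ testOrder γ * D) * holderSeminorm d γ K ξ * A * l ^ γ := by
        gcongr

/-- The pairing of a distribution of negative regularity with the product of a test function and a
smooth function oscillating at scale `l`. -/
theorem exists_bound_mulTest (d : ℕ) (hγ : γ < 0) (R : ℝ) :
    ∃ (K : Compacts (Rd d)) (C : ℝ), 0 ≤ C ∧ ∀ (ξ : Holder d γ) (l : ℝ), 0 < l → l ≤ 1 →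
      ∀ (h : Rd d → ℝ) (hh : ContDiff ℝ ∞ h) (φ : Test d) (F A : ℝ), 0 ≤ F →
      (∀ y, R < ‖y‖ → φ y = 0) →
      (∀ y, ‖y‖ ≤ R → ∀ k ≤ testOrder γ, ‖iteratedFDeriv ℝ k h y‖ ≤ F * (l ^ k)⁻¹) →
      (∀ k ≤ testOrder γ, ∀ y, ‖iteratedFDeriv ℝ k (φ : Rd d → ℝ) y‖ ≤ A) →
      |ξ.toDistr (mulTest h hh φ)| ≤ C * holderSeminorm d γ K ξ * F * A * l ^ γ := by
  obtain ⟨K, C, hC0, hC⟩ := exists_bound_of_scale d hγ R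
  refine ⟨K, C * 2 ^ testOrder γ, by positivity, ?_⟩
  intro ξ l hl hl1 h hh φ F A hF0 hφ hF hA
  have hA0 : 0 ≤ A := (norm_nonneg _).trans (hA 0 (Nat.zero_le _) 0)
  have h0 : ∀ y, R < ‖y‖ → mulTest h hh φ y = 0 := fun y hy => mulTest_eq_zero (hφ y hy)
  refine (hC ξ l hl hl1 (mulTest h hh φ) (2 ^ testOrder γ * F * A) h0 fun k hk y => ?_).trans_eq
    (by ring)
  -- Inside the ball, `A ≤ A * (l ^ i)⁻¹` because `l ≤ 1`. Outside it nothing is known about `h`,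
  -- but the product vanishes near `y`.
  by_cases hy : ‖y‖ ≤ R
  · refine norm_iteratedFDeriv_mulTest_le hh φ hl (hF y hy) (fun i hi => (hA i hi y).trans ?_) hk
    exact le_mul_of_one_le_right hA0 ((one_le_inv₀ (pow_pos hl i)).2 (pow_le_one₀ hl.le hl1))
  · rw [iteratedFDeriv_eq_zero_of_ball (x := 0) (R := R) (by simpa using h0) k
      (by simpa using hy), norm_zero]
    positivity

/-! ### Mollifiers with vanishing moments -/

theorem integral_rescale_mul (φ : Test d) (x : Rd d) (l : ℝ) (hl : 0 < l) (G : Rd d → ℝ) :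
    ∫ y, rescale φ x l hl y * G y = ∫ z, φ z * G (x + l • z) := by
  rw [← integral_add_left_eq_self _ x]
  have h := Measure.integral_comp_inv_smul_of_nonneg (volume : Measure (Rd d))
    (fun z => (l ^ d)⁻¹ * (φ z * G (x + l • z))) hl.le
  have e : ∀ y : Rd d, rescale φ x l hl (x + y) * G (x + y) =
      (l ^ d)⁻¹ * (φ (l⁻¹ • y) * G (x + l • l⁻¹ • y)) := fun y => by
    rw [rescale_apply, add_sub_cancel_left, smul_inv_smul₀ hl.ne', mul_assoc]
  simp_rw [e]
  rw [h, integral_const_mul, finrank_euclideanSpace_fin, smul_eq_mul,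
    mul_inv_cancel_left₀ (pow_ne_zero _ hl.ne')]

theorem integral_rescale_monomial (φ : Test d) (l : ℝ) (hl : 0 < l) (k : Fin d → ℕ) :
    ∫ y, rescale φ 0 l hl y * ∏ i, y i ^ k i =
      l ^ (∑ i, k i) * ∫ y, φ y * ∏ i, y i ^ k i := by
  rw [integral_rescale_mul φ 0 l hl fun y => ∏ i, y i ^ k i, ← integral_const_mul]
  refine integral_congr_ae (Eventually.of_forall fun z => ?_)
  simp only [zero_add, PiLp.smul_apply, smul_eq_mul, mul_pow, Finset.prod_mul_distrib,
    Finset.prod_pow_eq_pow_sum]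
  ring

/-- Rescaling by `1/2` multiplies moments of degree `m` by `2 ^ (-m)`. The combination `(c ρ^{1/2} -
ρ) / (c - 1)` with `c = 2 ^ (n + 1)` thus kills degree `n + 1`, keeps the integral equal to one and
leaves the vanishing moments at zero. -/
theorem exists_mollifier (d n : ℕ) : ∃ ρ : Test d, (∀ y, 1 / 2 < ‖y‖ → ρ y = 0) ∧
    ∫ y, ρ y = 1 ∧
    ∀ k : Fin d → ℕ, 0 < ∑ i, k i → ∑ i, k i ≤ n → ∫ y, ρ y * ∏ i, y i ^ k i = 0 := by
  induction n with
  | zero =>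
    let b : ContDiffBump (0 : Rd d) := ⟨1 / 4, 1 / 2, by norm_num, by norm_num⟩
    have hb : ∀ y, 1 / 2 < ‖y‖ → b.normed volume y = 0 := fun y hy => by
      by_contra hc
      have : y ∈ Function.support (b.normed volume) := hc
      rw [b.support_normed_eq, mem_ball_zero_iff] at this
      change ‖y‖ < 1 / 2 at this
      linarith
    refine ⟨testOfBall (b.normed volume) b.contDiff_normed 0 (1 / 2) (by simpa using hb), hb,
      b.integral_normed, fun k h1 h2 => by omega⟩
  | succ n ih =>
    obtain ⟨ρ, hs, hi, hm⟩ := ih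
    let c : ℝ := 2 ^ (n + 1)
    have hc : c - 1 ≠ 0 := by
      have : (1 : ℝ) < c := one_lt_pow₀ one_lt_two (Nat.succ_ne_zero n)
      linarith
    let ρ' : Test d := (c - 1)⁻¹ • (c • rescale ρ 0 (1 / 2) one_half_pos - ρ)
    have hmom : ∀ k : Fin d → ℕ, ∫ y, ρ' y * ∏ i, y i ^ k i =
        (c - 1)⁻¹ * (c * (1 / 2) ^ (∑ i, k i) - 1) * ∫ y, ρ y * ∏ i, y i ^ k i := by
      intro k
      have hG : Continuous fun y : Rd d => ∏ i, y i ^ k i := by fun_prop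
      have e : ∀ y, ρ' y * ∏ i, y i ^ k i =
          (c - 1)⁻¹ * (c * (rescale ρ 0 (1 / 2) one_half_pos y * ∏ i, y i ^ k i) -
            ρ y * ∏ i, y i ^ k i) := fun y => by
        change (c - 1)⁻¹ * (c * rescale ρ 0 (1 / 2) one_half_pos y - ρ y) * _ = _
        ring
      simp_rw [e]
      rw [integral_const_mul, integral_sub ((integrable_test_mul _ hG).const_mul c)
        (integrable_test_mul _ hG), integral_const_mul, integral_rescale_monomial]
      ring
    refine ⟨ρ', fun y hy => ?_, ?_, fun k h1 h2 => ?_⟩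
    · change (c - 1)⁻¹ * (c * rescale ρ 0 (1 / 2) one_half_pos y - ρ y) = 0
      rw [hs y hy, rescale_eq_zero hs one_half_pos (by rw [sub_zero]; linarith)]
      simp
    · have := hmom 0
      simp only [Pi.zero_apply, pow_zero, Finset.prod_const_one, mul_one, Finset.sum_const_zero,
        hi] at this
      rw [this, inv_mul_cancel₀ hc]
    · rw [hmom]
      rcases h2.lt_or_eq with h | h
      · rw [hm k h1 (by omega), mul_zero]
      · rw [h]
        have : c * (1 / 2 : ℝ) ^ (n + 1) = 1 := by
          rw [← mul_pow]; norm_num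
        rw [this, sub_self, mul_zero, zero_mul]

/-- The difference of two consecutive dyadic rescalings of a mollifier. -/
def dyadicDiff (ρ : Test d) : Test d := rescale ρ 0 (1 / 2) one_half_pos - ρ

theorem dyadicDiff_eq_zero {ρ : Test d} (hs : ∀ y, 1 / 2 < ‖y‖ → ρ y = 0) :
    ∀ y, 1 / 2 < ‖y‖ → dyadicDiff ρ y = 0 := fun y hy => by
  change rescale ρ 0 (1 / 2) one_half_pos y - ρ y = 0
  rw [hs y hy, rescale_eq_zero hs one_half_pos (by rw [sub_zero]; linarith), sub_zero]

/-- The integral is invariant under rescaling, so degree zero cancels in the difference; the higher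
moments vanish for both terms. -/
theorem annihilates_dyadicDiff {ρ : Test d} (hm : ∀ k : Fin d → ℕ, 0 < ∑ i, k i →
    ((∑ i, k i : ℕ) : ℝ) ≤ γ → ∫ y, ρ y * ∏ i, y i ^ k i = 0) : Annihilates γ (dyadicDiff ρ) := by
  intro k hk
  have hG : Continuous fun y : Rd d => ∏ i, y i ^ k i := by fun_prop
  have e : ∀ y, dyadicDiff ρ y * ∏ i, y i ^ k i =
      rescale ρ 0 (1 / 2) one_half_pos y * ∏ i, y i ^ k i - ρ y * ∏ i, y i ^ k i :=
    fun y => sub_mul _ _ _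
  simp_rw [e]
  rw [integral_sub (integrable_test_mul _ hG) (integrable_test_mul _ hG),
    integral_rescale_monomial]
  rcases Nat.eq_zero_or_pos (∑ i, k i) with h | h
  · rw [h, pow_zero, one_mul, sub_self]
  · rw [hm k h hk, mul_zero, sub_zero]

/-! ### Construction of the product -/

/-- Test functions supported in the ball of radius `1/2`. -/
abbrev SmallTest (d : ℕ) : Type := {κ : Test d // ∀ y, 1 / 2 < ‖y‖ → κ y = 0}

/-- The scale `1`. -/
def unitScale : Set.Ioc (0 : ℝ) 1 := ⟨1, Set.mem_Ioc.2 ⟨one_pos, le_rfl⟩⟩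

/-- The pairing of the distribution `f`, multiplied by `y ↦ g (κ_y^l)`, with a test function. -/
def smearPairing (κ : SmallTest d) (l : Set.Ioc (0 : ℝ) 1) (f : Holder d γ) (g : Holder d δ)
    (φ : Test d) : ℝ :=
  f.toDistr (mulTest (smear g.toDistr κ.1 l.1 l.2.1) (contDiff_smear g κ.2 l.2.1 l.2.2) φ)

section

variable (κ : SmallTest d) (l : Set.Ioc (0 : ℝ) 1) (f f' : Holder d γ) (g g' : Holder d δ)
  (φ φ' : Test d) (c : ℝ)

theorem smearPairing_add_left :
    smearPairing κ l (f + f') g φ = smearPairing κ l f g φ + smearPairing κ l f' g φ := by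
  rw [smearPairing, map_add]; rfl

theorem smearPairing_smul_left :
    smearPairing κ l (c • f) g φ = c * smearPairing κ l f g φ := by
  rw [smearPairing, map_smul]; rfl

theorem smearPairing_add_middle :
    smearPairing κ l f (g + g') φ = smearPairing κ l f g φ + smearPairing κ l f g' φ := by
  rw [smearPairing, smearPairing, smearPairing, ← map_add]
  congr 1
  ext y
  exact add_mul _ _ _

theorem smearPairing_smul_middle :
    smearPairing κ l f (c • g) φ = c * smearPairing κ l f g φ := by
  rw [smearPairing, smearPairing, ← smul_eq_mul, ← map_smul]
  congr 1
  ext y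
  exact mul_assoc _ _ _

theorem smearPairing_add_right :
    smearPairing κ l f g (φ + φ') = smearPairing κ l f g φ + smearPairing κ l f g φ' := by
  rw [smearPairing, smearPairing, smearPairing, ← map_add]
  congr 1
  ext y
  exact mul_add _ _ _

theorem smearPairing_smul_right :
    smearPairing κ l f g (c • φ) = c * smearPairing κ l f g φ := by
  rw [smearPairing, smearPairing, ← smul_eq_mul, ← map_smul]
  congr 1
  ext y
  exact mul_left_comm _ _ _

end

/-- The smearing has amplitude `l ^ δ` at scale `l`, and testing `f` at that scale costs `l ^ γ`.
The compact sets are chosen before `κ`, so that the bounds for the coarse kernel and for the dyadic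
corrections use the same seminorms and can be added. -/
theorem exists_bound_smearPairing (d : ℕ) (hγ : γ < 0) (δ R : ℝ) :
    ∃ (K K' : Compacts (Rd d)), ∀ κ : SmallTest d, ∃ C : ℝ, 0 ≤ C ∧
      (Annihilates δ κ.1 → ∀ (l : Set.Ioc (0 : ℝ) 1) (f : Holder d γ) (g : Holder d δ)
        (φ : Test d) (A : ℝ), (∀ y, R < ‖y‖ → φ y = 0) →
        (∀ k ≤ testOrder γ, ∀ y, ‖iteratedFDeriv ℝ k (φ : Rd d → ℝ) y‖ ≤ A) →
        |smearPairing κ l f g φ| ≤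
          C * holderSeminorm d γ K f * holderSeminorm d δ K' g * A * (l : ℝ) ^ (γ + δ)) ∧
      ∀ (f : Holder d γ) (g : Holder d δ)
        (φ : Test d) (A : ℝ), (∀ y, R < ‖y‖ → φ y = 0) →
        (∀ k ≤ testOrder γ, ∀ y, ‖iteratedFDeriv ℝ k (φ : Rd d → ℝ) y‖ ≤ A) →
        |smearPairing κ unitScale f g φ| ≤
          C * holderSeminorm d γ K f * holderSeminorm d δ K' g * A := by
  obtain ⟨K, C, hC0, hC⟩ := exists_bound_mulTest d hγ R
  let K' : Compacts (Rd d) := ⟨closedBall 0 R, isCompact_closedBall _ _⟩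
  have hK' : ∀ y : Rd d, ‖y‖ ≤ R → y ∈ K' := fun y hy => mem_closedBall_zero_iff.2 hy
  refine ⟨K, K', fun κ => ?_⟩
  obtain ⟨D, hD0, hD⟩ := exists_bound_derivs κ.1 (testOrder δ + testOrder γ)
  refine ⟨C * D, by positivity, fun ha l f g φ A hφ hA => ?_, fun f g φ A hφ hA => ?_⟩
  · have hl := l.2.1
    have h := hC f l l.2.1 l.2.2 (smear g.toDistr κ.1 l.1 l.2.1)
      (contDiff_smear g κ.2 l.2.1 l.2.2) φ (holderSeminorm d δ K' g * D * (l : ℝ) ^ δ) A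
      (by positivity) hφ (fun y hy k hk => norm_iteratedFDeriv_smear_le g K' κ.2 ha l.2.1 l.2.2
        (fun j hj => hD j (by omega)) (hK' y hy)) hA
    refine h.trans_eq ?_
    rw [Real.rpow_add hl]
    ring
  · have h := hC f 1 one_pos le_rfl (smear g.toDistr κ.1 1 one_pos)
      (contDiff_smear g κ.2 one_pos le_rfl) φ (holderSeminorm d δ K' g * D) A
      (by positivity) hφ (fun y hy k hk => by
        rw [one_pow, inv_one, mul_one]
        exact norm_iteratedFDeriv_smear_one_le g K' κ.2 (fun j hj => hD j (by omega))
          (hK' y hy)) hA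
    refine h.trans_eq ?_
    rw [Real.one_rpow]
    ring

/-- The dyadic scale `2^{-n}`. -/
def dyadic (n : ℕ) : Set.Ioc (0 : ℝ) 1 :=
  ⟨(1 / 2) ^ n, by positivity, pow_le_one₀ (by norm_num) (by norm_num)⟩

theorem dyadic_rpow (n : ℕ) (s : ℝ) : (dyadic n : ℝ) ^ s = ((1 / 2 : ℝ) ^ s) ^ n := by
  change ((1 / 2 : ℝ) ^ n) ^ s = _
  rw [← Real.rpow_natCast, ← Real.rpow_natCast, ← Real.rpow_mul (by norm_num),
    ← Real.rpow_mul (by norm_num), mul_comm]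

theorem exists_radius (φ : Test d) : ∃ R, ∀ y, R < ‖y‖ → φ y = 0 := by
  obtain ⟨R, hR⟩ := exists_common_radius (isCompact_singleton (x := φ))
  exact ⟨R, hR φ rfl⟩

theorem dyadicRatio_lt_one (hs : 0 < γ + δ) : (1 / 2 : ℝ) ^ (γ + δ) < 1 :=
  Real.rpow_lt_one (by norm_num) (by norm_num) hs

theorem summable_smearPairing (hγ : γ < 0) (hs : 0 < γ + δ) {κ : SmallTest d}
    (ha : Annihilates δ κ.1) (f : Holder d γ) (g : Holder d δ) (φ : Test d) :
    Summable fun n => smearPairing κ (dyadic n) f g φ := by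
  obtain ⟨R, hR⟩ := exists_radius φ
  obtain ⟨A, -, hA⟩ := exists_bound_derivs φ (testOrder γ)
  obtain ⟨K, K', h⟩ := exists_bound_smearPairing d hγ δ R
  obtain ⟨C, -, hC, -⟩ := h κ
  refine Summable.of_norm_bounded (f := fun n => smearPairing κ (dyadic n) f g φ)
    (g := fun n => C * holderSeminorm d γ K f *
    holderSeminorm d δ K' g * A * ((1 / 2 : ℝ) ^ (γ + δ)) ^ n)
    ((summable_geometric_of_lt_one (by positivity) (dyadicRatio_lt_one hs)).mul_left _)
    fun n => ?_
  rw [← dyadic_rpow]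
  exact hC ha _ f g φ A hR hA

/-- The product of `f` and `g`, tested against `φ`: a coarse term and the dyadic corrections. -/
def prodPairing (ρ κ : SmallTest d) (f : Holder d γ) (g : Holder d δ) (φ : Test d) : ℝ :=
  smearPairing ρ unitScale f g φ + ∑' n, smearPairing κ (dyadic n) f g φ

theorem exists_bound_prodPairing (hγ : γ < 0) (hs : 0 < γ + δ) (ρ : SmallTest d)
    {κ : SmallTest d} (ha : Annihilates δ κ.1) (R : ℝ) :
    ∃ (K K' : Compacts (Rd d)) (C : ℝ), 0 ≤ C ∧ ∀ (f : Holder d γ) (g : Holder d δ) (φ : Test d)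
      (A : ℝ), (∀ y, R < ‖y‖ → φ y = 0) →
      (∀ k ≤ testOrder γ, ∀ y, ‖iteratedFDeriv ℝ k (φ : Rd d → ℝ) y‖ ≤ A) →
      |prodPairing ρ κ f g φ| ≤ C * holderSeminorm d γ K f * holderSeminorm d δ K' g * A := by
  obtain ⟨K, K', h⟩ := exists_bound_smearPairing d hγ δ R
  obtain ⟨C, hC0, hC, -⟩ := h κ
  obtain ⟨D, hD0, -, hD⟩ := h ρ
  have hq := dyadicRatio_lt_one hs
  refine ⟨K, K', D + C * (1 - (1 / 2 : ℝ) ^ (γ + δ))⁻¹,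
    add_nonneg hD0 (mul_nonneg hC0 (inv_nonneg.2 (by linarith))), fun f g φ A hφ hA => ?_⟩
  have hsum := (hasSum_geometric_of_lt_one (by positivity) hq).mul_left
    (C * holderSeminorm d γ K f * holderSeminorm d δ K' g * A)
  have h2 : |∑' n, smearPairing κ (dyadic n) f g φ| ≤ _ :=
    tsum_of_norm_bounded (f := fun n => smearPairing κ (dyadic n) f g φ) hsum fun n => by
      rw [← dyadic_rpow]
      exact hC ha _ f g φ A hφ hA
  refine (abs_add_le _ _).trans ((add_le_add (hD f g φ A hφ hA) h2).trans_eq ?_)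
  ring

/-- The product as a distribution. -/
def prodDistr (hγ : γ < 0) (hs : 0 < γ + δ) (ρ κ : SmallTest d) (ha : Annihilates δ κ.1)
    (f : Holder d γ) (g : Holder d δ) : Distr d :=
  distrOfBound (testOrder γ)
    { toFun := prodPairing ρ κ f g
      map_add' := fun φ φ' => by
        simp only [prodPairing, smearPairing_add_right]
        rw [Summable.tsum_add (summable_smearPairing hγ hs ha f g φ)
          (summable_smearPairing hγ hs ha f g φ')]
        ring
      map_smul' := fun c φ => by
        simp only [prodPairing, smearPairing_smul_right, tsum_mul_left, RingHom.id_apply,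
          smul_eq_mul, mul_add] }
    fun R => by
      obtain ⟨K, K', C, hC0, hC⟩ := exists_bound_prodPairing hγ hs ρ ha R
      exact ⟨C * holderSeminorm d γ K f * holderSeminorm d δ K' g, by positivity,
        fun φ A hφ hA => hC f g φ A hφ hA⟩

/-- The product as a bilinear map. -/
def prodBilin (hγ : γ < 0) (hs : 0 < γ + δ) (ρ κ : SmallTest d) (ha : Annihilates δ κ.1) :
    Holder d γ →ₗ[ℝ] Holder d δ →ₗ[ℝ] Distr d :=
  LinearMap.mk₂ ℝ (prodDistr hγ hs ρ κ ha)
    (fun f f' g => by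
      ext φ
      change prodPairing ρ κ _ _ _ = prodPairing ρ κ _ _ _ + prodPairing ρ κ _ _ _
      simp only [prodPairing, smearPairing_add_left]
      rw [Summable.tsum_add (summable_smearPairing hγ hs ha f g φ)
        (summable_smearPairing hγ hs ha f' g φ)]
      ring)
    (fun c f g => by
      ext φ
      change prodPairing ρ κ _ _ _ = c * prodPairing ρ κ _ _ _
      simp only [prodPairing, smearPairing_smul_left, tsum_mul_left, mul_add])
    (fun f g g' => by
      ext φ
      change prodPairing ρ κ _ _ _ = prodPairing ρ κ _ _ _ + prodPairing ρ κ _ _ _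
      simp only [prodPairing, smearPairing_add_middle]
      rw [Summable.tsum_add (summable_smearPairing hγ hs ha f g φ)
        (summable_smearPairing hγ hs ha f g' φ)]
      ring)
    (fun c f g => by
      ext φ
      change prodPairing ρ κ _ _ _ = c * prodPairing ρ κ _ _ _
      simp only [prodPairing, smearPairing_smul_middle, tsum_mul_left, mul_add])

theorem continuous_prodBilin (hγ : γ < 0) (hs : 0 < γ + δ) (ρ κ : SmallTest d)
    (ha : Annihilates δ κ.1) :
    Continuous fun p : Holder d γ × Holder d δ => prodBilin hγ hs ρ κ ha p.1 p.2 :=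
  continuous_bilinear_of_bound (testOrder γ) _ fun R => exists_bound_prodPairing hγ hs ρ ha R

/-- The partial sums of the dyadic corrections telescope. -/
theorem tendsto_smearPairing (hγ : γ < 0) (hs : 0 < γ + δ) (ρ : SmallTest d)
    (ha : Annihilates δ (dyadicDiff ρ.1)) (f : Holder d γ) (g : Holder d δ) (φ : Test d) :
    Tendsto (fun n => smearPairing ρ (dyadic n) f g φ) atTop
      (𝓝 (prodPairing ρ ⟨dyadicDiff ρ.1, dyadicDiff_eq_zero ρ.2⟩ f g φ)) := by
  have h := ((summable_smearPairing hγ hs (κ := ⟨dyadicDiff ρ.1, dyadicDiff_eq_zero ρ.2⟩) ha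
    f g φ).hasSum.tendsto_sum_nat).const_add (smearPairing ρ unitScale f g φ)
  refine h.congr fun n => ?_
  -- Rescaling the dyadic difference to scale `l` gives the mollifier at scale `l / 2` minus the
  -- mollifier at scale `l`.
  have hstep : ∀ n, smearPairing ⟨dyadicDiff ρ.1, dyadicDiff_eq_zero ρ.2⟩ (dyadic n) f g φ =
      smearPairing ρ (dyadic (n + 1)) f g φ - smearPairing ρ (dyadic n) f g φ := by
    intro n
    rw [smearPairing, smearPairing, smearPairing, ← map_sub]
    congr 1
    ext y
    change g.toDistr (rescale (dyadicDiff ρ.1) y _ _) * φ y =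
      g.toDistr (rescale ρ.1 y _ _) * φ y - g.toDistr (rescale ρ.1 y _ _) * φ y
    rw [dyadicDiff, rescale_sub, map_sub, rescale_rescale_zero, sub_mul]
    rfl
  simp_rw [hstep]
  rw [Finset.sum_range_sub (fun n => smearPairing ρ (dyadic n) f g φ)]
  have h0 : dyadic 0 = unitScale := Subtype.ext (pow_zero _)
  rw [h0]
  ring

/-! ### Continuous functions -/

theorem ofContinuous_apply (f : C(Rd d, ℝ)) (φ : Test d) :
    ofContinuous f φ = ∫ y, f y * φ y := rfl

theorem ofContinuous_rescale (f : C(Rd d, ℝ)) (φ : Test d) (x : Rd d) (l : ℝ) (hl : 0 < l) :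
    ofContinuous f (rescale φ x l hl) = ∫ z, φ z * f (x + l • z) := by
  rw [ofContinuous_apply, ← integral_rescale_mul φ x l hl f]
  exact integral_congr_ae (Eventually.of_forall fun y => mul_comm _ _)

theorem exists_bound_ball (f : C(Rd d, ℝ)) (R : ℝ) : ∃ M, 0 ≤ M ∧ ∀ y, ‖y‖ ≤ R → |f y| ≤ M := by
  obtain ⟨M, hM⟩ := (isCompact_closedBall (0 : Rd d) R).exists_bound_of_continuousOn
    f.continuous.continuousOn
  exact ⟨|M|, abs_nonneg _, fun y hy =>
    (hM y (mem_closedBall_zero_iff.2 hy)).trans (le_abs_self _)⟩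

theorem norm_add_smul_le {x z : Rd d} {R l : ℝ} (hx : ‖x‖ ≤ R) (hz : ‖z‖ ≤ 1) (hl : 0 < l)
    (hl1 : l ≤ 1) : ‖x + l • z‖ ≤ R + 1 := by
  refine (norm_add_le _ _).trans (add_le_add hx ?_)
  rw [norm_smul, Real.norm_eq_abs, abs_of_pos hl]
  exact mul_le_one₀ hl1 (norm_nonneg _) hz

/-- Continuous functions have any negative regularity. -/
theorem ofContinuous_mem_holderSubmodule (hγ : γ < 0) (f : C(Rd d, ℝ)) :
    ofContinuous f ∈ holderSubmodule d γ := by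
  intro K
  obtain ⟨R, hR⟩ := K.isCompact.isBounded.exists_norm_le
  obtain ⟨M, hM0, hM⟩ := exists_bound_ball f (R + 1)
  let V : ℝ := volume.real (closedBall (0 : Rd d) 1)
  have key : ∀ φ ∈ unitTests d (testOrder γ), ∀ x ∈ (K : Set (Rd d)), ∀ (l : ℝ) (hl : 0 < l),
      l ≤ 1 → |ofContinuous f (rescale φ x l hl)| ≤ M * V := by
    intro φ hφ x hx l hl hl1
    rw [ofContinuous_rescale]
    have h0 : ∀ z ∉ closedBall (0 : Rd d) 1, φ z * f (x + l • z) = 0 := fun z hz => by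
      rw [image_eq_zero_of_notMem_tsupport fun h => hz (hφ.1 h), zero_mul]
    rw [← setIntegral_eq_integral_of_forall_compl_eq_zero h0, ← Real.norm_eq_abs]
    refine norm_setIntegral_le_of_norm_le_const
      (isCompact_closedBall (0 : Rd d) 1).measure_lt_top fun z hz => ?_
    have h1 := hφ.2 0 (Nat.zero_le _) z
    rw [norm_iteratedFDeriv_zero] at h1
    rw [norm_mul]
    exact (mul_le_mul h1 (hM _ (norm_add_smul_le (hR x hx) (mem_closedBall_zero_iff.1 hz) hl hl1))
      (abs_nonneg _) zero_le_one).trans_eq (one_mul _)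
  refine ⟨M * V, ?_⟩
  rintro ψ (⟨φ, hφ, x, hx, rfl⟩ | ⟨φ, hφ, -, x, hx, l, hl, hl1, rfl⟩)
  · exact key φ hφ x hx 1 one_pos le_rfl
  · rw [map_smul, smul_eq_mul, abs_mul, abs_of_pos (Real.rpow_pos_of_pos hl _)]
    -- Negativity of `γ` enters here: the weight is at most one, so the uniform bound on `f`
    -- suffices.
    have h1 : l ^ (-γ) ≤ 1 := Real.rpow_le_one hl.le hl1 (by linarith)
    exact (mul_le_of_le_one_left (abs_nonneg _) h1).trans (key φ hφ x hx l hl hl1)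

theorem tendsto_dyadic : Tendsto (fun n => (dyadic n : ℝ)) atTop (𝓝 0) :=
  tendsto_pow_atTop_nhds_zero_of_lt_one (r := 1 / 2) (by norm_num) (by norm_num)

/-- Mollifications of a continuous function converge, also after integration. -/
theorem tendsto_smearPairing_ofContinuous (ρ : SmallTest d) (hρ : ∫ y, ρ.1 y = 1)
    (f g : C(Rd d, ℝ)) (hf : ofContinuous f ∈ holderSubmodule d γ)
    (hg : ofContinuous g ∈ holderSubmodule d δ) (φ : Test d) :
    Tendsto (fun n => smearPairing ρ (dyadic n) (⟨ofContinuous f, hf⟩ : Holder d γ)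
      (⟨ofContinuous g, hg⟩ : Holder d δ) φ) atTop (𝓝 (ofContinuous (f * g) φ)) := by
  obtain ⟨R, hR⟩ := exists_radius φ
  obtain ⟨M, hM0, hM⟩ := exists_bound_ball g (R + 1)
  -- The mollification of `g`. Dominated convergence is used twice: in `z` for the pointwise limit
  -- `a n y → g y` on the ball, and in `y` for the pairing with `f` and `φ`.
  let a : ℕ → Rd d → ℝ := fun n y => ∫ z, ρ.1 z * g (y + (dyadic n : ℝ) • z)
  have hρint : Integrable ρ.1 := ρ.1.continuous.integrable_of_hasCompactSupport
    ρ.1.hasCompactSupport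
  have hint : ∀ n y, ‖y‖ ≤ R → ∀ z, ‖ρ.1 z * g (y + (dyadic n : ℝ) • z)‖ ≤ M * ‖ρ.1 z‖ := by
    intro n y hy z
    by_cases hz : ‖z‖ ≤ 1
    · rw [norm_mul, mul_comm]
      gcongr
      exact hM _ (norm_add_smul_le hy hz (dyadic n).2.1 (dyadic n).2.2)
    · rw [ρ.2 z (by linarith [not_le.1 hz])]
      simp
  have ha : ∀ y, ‖y‖ ≤ R → Tendsto (fun n => a n y) atTop (𝓝 (g y)) := by
    intro y hy
    have h1 : ∫ z, ρ.1 z * g y = g y := by rw [integral_mul_const, hρ, one_mul]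
    rw [← h1]
    refine tendsto_integral_of_dominated_convergence (fun z => M * ‖ρ.1 z‖) (fun n => ?_)
      (hρint.norm.const_mul M) (fun n => Eventually.of_forall (hint n y hy))
      (Eventually.of_forall fun z => ?_)
    · have hc : Continuous fun z : Rd d => y + (dyadic n : ℝ) • z :=
        continuous_const.add (continuous_const_smul _)
      have hc' : Continuous fun z => ρ.1 z * g (y + (dyadic n : ℝ) • z) :=
        ρ.1.continuous.mul (g.continuous.comp hc)
      exact hc'.aestronglyMeasurable
    · have h2 := (tendsto_dyadic.smul_const z).const_add y
      rw [zero_smul, add_zero] at h2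
      have h3 : Tendsto (fun n => g (y + (dyadic n : ℝ) • z)) atTop (𝓝 (g y)) :=
        (g.continuous.tendsto y).comp h2
      exact h3.const_mul (ρ.1 z)
  have e : ∀ n, smearPairing ρ (dyadic n) (⟨ofContinuous f, hf⟩ : Holder d γ)
      (⟨ofContinuous g, hg⟩ : Holder d δ) φ = ∫ y, f y * (a n y * φ y) := by
    intro n
    change ∫ y, f y * (ofContinuous g (rescale ρ.1 y _ _) * φ y) = _
    simp_rw [ofContinuous_rescale]
    rfl
  -- Continuity, needed for measurability, is read off from the smoothness of smeared distributions.
  have hcont : ∀ n, Continuous (a n) := by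
    intro n
    have h : a n = smear (Holder.toDistr (⟨ofContinuous g, hg⟩ : Holder d δ)) ρ.1 (dyadic n)
        (dyadic n).2.1 := funext fun y => (ofContinuous_rescale g ρ.1 y _ _).symm
    rw [h]
    exact (contDiff_smear _ ρ.2 _ (dyadic n).2.2).continuous
  simp_rw [e]
  rw [ofContinuous_apply]
  refine tendsto_integral_of_dominated_convergence
    (fun y => (M * ∫ z, ‖ρ.1 z‖) * ‖f y * φ y‖) (fun n => ?_) ?_
    (fun n => Eventually.of_forall fun y => ?_) (Eventually.of_forall fun y => ?_)
  · exact (f.continuous.mul ((hcont n).mul φ.continuous)).aestronglyMeasurable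
  · exact ((f.continuous.mul φ.continuous).integrable_of_hasCompactSupport
      φ.hasCompactSupport.mul_left).norm.const_mul _
  · by_cases hy : ‖y‖ ≤ R
    · have h : ‖a n y‖ ≤ M * ∫ z, ‖ρ.1 z‖ := by
        rw [← integral_const_mul]
        exact norm_integral_le_of_norm_le (hρint.norm.const_mul M)
          (Eventually.of_forall (hint n y hy))
      calc ‖f y * (a n y * φ y)‖ = ‖a n y‖ * ‖f y * φ y‖ := by
            simp only [norm_mul]; ring
        _ ≤ _ := by gcongr
    · rw [hR y (not_le.1 hy)]
      simp
  · by_cases hy : ‖y‖ ≤ R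
    · rw [ContinuousMap.mul_apply, mul_assoc]
      exact ((ha y hy).mul_const _).const_mul _
    · rw [hR y (not_le.1 hy)]
      simp

end HolderBesov

end

theorem mainTheorem9 (d : ℕ) (hd : 1 ≤ d) (α β : ℝ) (hα : 0 < α) (hαβ : α < β) :
    ∃ B : HolderBesov.Holder d (-α) →ₗ[ℝ] HolderBesov.Holder d β →ₗ[ℝ] HolderBesov.Distr d,
      Continuous (fun p : HolderBesov.Holder d (-α) × HolderBesov.Holder d β => B p.1 p.2) ∧
      ∀ (f g : C(HolderBesov.Rd d, ℝ))
        (hg : HolderBesov.ofContinuous g ∈ HolderBesov.holderSubmodule d β),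
        ∃ hf : HolderBesov.ofContinuous f ∈ HolderBesov.holderSubmodule d (-α),
          B ⟨HolderBesov.ofContinuous f, hf⟩ ⟨HolderBesov.ofContinuous g, hg⟩ =
            HolderBesov.ofContinuous (f * g) := by
  open HolderBesov in
  -- An integer degree at most `β` is at most `⌈β⌉₊`, so these vanishing moments suffice for
  -- annihilation at level `β`.
  obtain ⟨ρ, hsupp, hint, hmom⟩ := exists_mollifier d ⌈β⌉₊
  have hγ : -α < 0 := by linarith
  have hs : 0 < -α + β := by linarith
  have ha : Annihilates β (dyadicDiff ρ) := annihilates_dyadicDiff fun k h1 h2 =>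
    hmom k h1 (by exact_mod_cast h2.trans (Nat.le_ceil β))
  refine ⟨prodBilin hγ hs ⟨ρ, hsupp⟩ ⟨dyadicDiff ρ, dyadicDiff_eq_zero hsupp⟩ ha,
    continuous_prodBilin hγ hs _ _ ha, fun f g hg =>
    ⟨ofContinuous_mem_holderSubmodule hγ f, ?_⟩⟩
  ext φ
  -- Both sides are limits of the same mollified pairings, one by telescoping and the other by
  -- dominated convergence.
  exact tendsto_nhds_unique (tendsto_smearPairing hγ hs ⟨ρ, hsupp⟩ ha _ _ φ)
    (tendsto_smearPairing_ofContinuous ⟨ρ, hsupp⟩ hint f g _ hg φ)
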